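/- **Setting.** There are $K\ge 1$ items, a monotonically increasing link function $\mu:\mathbb R\to\mathbb R$ with $\mu(x)+\mu(-x)=1$, known feature vectors $\phi_{i,j}\in\mathbb R^d$ ($d\ge1$, $i,j\in[K]$) with $\|\phi_{i,j}\|\le 1$ and $\phi_{i,j}=-\phi_{j,i}$, and an unknown $\theta^*\in\mathbb R^d$ such that $p_{i,j}:=\mu(\phi_{i,j}^\top\theta^*)\in[0,1]$. In each round $t=1,\dots,T$ a pair $(i_t,j_t)$ is queried and, given the past and the pair, the feedback $r_t\in\{0,1\}$ is Bernoulli with mean $p_{i_t,j_t}$. With the Borda score $B(i)=\frac1K\sum_{j}p_{i,j}$, the Borda regret is $$\mathrm{Regret}(T)=\sum_{t=1}^T\bigl(2\max_i B(i)-B(i_t)-B(j_t)\bigr).$$ **Assumptions.** (1) $\lambda_{\min}\bigl(\frac1{K^2}\sum_{i,j}\phi_{i,j}\phi_{i,j}^\top\bigr)\ge\lambda_0>0$. (2) $\kappa:=\inf_{\|x\|\le1,\ \|\theta-\theta^*\|\le1}\mu'(x^\top\theta)>0$. (3) $\mu$ is twice differentiable with $\mu'\le L_\mu$ and $\mu''\le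 M_\mu$. The numbers $\lambda_0,L_\mu,M_\mu$ are regarded as constants. **Algorithm BETC-GLM** (parameters $\tau\in\mathbb N$, $\varepsilon>0$). For a probability distribution $\pi$ on $[K]^2$ let $V(\pi)=\sum_{i,j}\pi(i,j)\phi_{i,j}\phi_{i,j}^\top$ and $g(\pi)=\max_{i,j}\phi_{i,j}^\top V(\pi)^{-1}\phi_{i,j}$ ($=\infty$ if $V(\pi)$ is singular). A G-optimal design is a minimizer of $g$. - For $\tau$ rounds, query $(i_t,j_t)$ with $i_t,j_t$ independent and uniform on $[K]$. - Take a G-optimal design $\pi$ with $|\mathrm{supp}(\pi)|\le d(d+1)/2$, and query every pair $(i,j)$, in lexicographic order, $N(i,j)=\lceil d\,\pi(i,j)/\varepsilon^2\rceil$ times. Let $N=\sum_{i,j}N(i,j)$. - Let $\hat\theta$ be a solution of $\sum_{t\le\tau+N}\mu(\phi_{i_t,j_t}^\top\hat\theta)\phi_{i_t,j_t}=\sum_{t\le\tau+N}r_t\phi_{i_t,j_t}$ (arbitrary if there is no solution), and let $\hat i$ maximize $\hat B(i)=\frac1K\sum_j\mu(\phi_{i,j}^\top\hat\theta)$. Query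 $(\hat i,\hat i)$ in all remaining rounds. The run is stopped after round $T$ (during exploration if $\tau+N>T$). **Theorem.** There is a universal constant $C_0>0$ such that for all $C_4\ge C_0$ and all $\lambda_0,c>0$ and $L_\mu,M_\mu$ there is a constant $C>0$, depending only on $C_4,\lambda_0,L_\mu,M_\mu,c$, with the following property. Suppose that the assumptions hold, $T\ge c\,d^2$ and $T\ge d$. Then a G-optimal design with support of size at most $d(d+1)/2$ exists, and for every such design: 1. For every $\delta>0$, BETC-GLM with $\tau=\lceil C_4\lambda_0^{-2}(d+\log(1/\delta))\rceil$ (read as $0$ if this is negative) and $\varepsilon=d^{1/6}T^{-1/3}$ satisfies, with probability at least $1-2\delta$, $$\mathrm{Regret}(T)\le C\,\kappa^{-1}d^{2/3}T^{2/3}\sqrt{\log\bigl(T/(d\delta)\bigr)},$$ where the square root of a negative number is read as $0$ (this matters only when $1-2\delta<0$). 2. With $\delta=T^{-1}$, $$\mathbb E[\mathrm{Regret}(T)]\le C\,\kappa^{-1}d^{2/3}T^{2/3}\sqrt{1+\log T},$$ that is, the expected regret is $\tilde O(\kappa^{-1}d^{2/3}T^{2/3})$. -/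

import Mathlib

noncomputable section

/-- A stochastic generalized linear dueling bandit with `K` items and `d`-dimensional features.
The preference probability of `i` over `j` is `link ⟪feature i j, param⟫`. -/
structure GLMDuelingBandit (K d : ℕ) where
  /-- The link function. -/
  link : ℝ → ℝ
  /-- The known feature vector of a pair of items. -/
  feature : Fin K → Fin K → EuclideanSpace ℝ (Fin d)
  /-- The unknown parameter. -/
  param : EuclideanSpace ℝ (Fin d)
  link_mono : Monotone link
  link_add_neg : ∀ x, link x + link (-x) = 1
  norm_feature_le : ∀ i j, ‖feature i j‖ ≤ 1
  feature_neg : ∀ i j, feature i j = -feature j i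
  link_mem : ∀ i j, link (inner ℝ (feature i j) param) ∈ Set.Icc (0 : ℝ) 1

/-- A history of `n` rounds: the queried pair and the binary feedback of each round
(`true` means that the first item of the pair won). -/
abbrev DuelHistory (K n : ℕ) : Type := Fin n → (Fin K × Fin K) × Bool

namespace GLMDuelingBandit

variable {K d : ℕ} (I : GLMDuelingBandit K d)

/-- The preference probability `p_{i,j}`. -/
def pref (i j : Fin K) : ℝ := I.link (inner ℝ (I.feature i j) I.param)

/-- The (shifted) Borda score computed with the parameter `θ` in place of the true one. -/
def bordaAt (θ : EuclideanSpace ℝ (Fin d)) (i : Fin K) : ℝ :=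
  (1 / (K : ℝ)) * ∑ j, I.link (inner ℝ (I.feature i j) θ)

/-- The Borda score `B(i)`. -/
def borda (i : Fin K) : ℝ := (1 / (K : ℝ)) * ∑ j, I.pref i j

/-- The Borda regret of a history: the sum over its rounds of `2 B(i⋆) - B(i_t) - B(j_t)`. -/
def regret {n : ℕ} (h : DuelHistory K n) : ℝ :=
  ∑ t, (2 * (⨆ i, I.borda i) - I.borda (h t).1.1 - I.borda (h t).1.2)

/-- `V(w) = ∑ w(i,j) φ_{i,j} φ_{i,j}ᵀ`. -/
def designMatrix (w : Fin K × Fin K → ℝ) : Matrix (Fin d) (Fin d) ℝ :=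
  ∑ p, w p • Matrix.vecMulVec (I.feature p.1 p.2).ofLp (I.feature p.1 p.2).ofLp

/-- The least eigenvalue of `K⁻² ∑ φ_{i,j} φ_{i,j}ᵀ` is at least `lam`. -/
def FeatureRegularity (lam : ℝ) : Prop :=
  (I.designMatrix (fun _ => 1 / (K : ℝ) ^ 2) - lam • (1 : Matrix (Fin d) (Fin d) ℝ)).PosSemidef

/-- `κ = inf { μ'(xᵀθ) : ‖x‖ ≤ 1, ‖θ - θ⋆‖ ≤ 1 }`. -/
def kappa : ℝ :=
  sInf {y | ∃ x θ : EuclideanSpace ℝ (Fin d), ‖x‖ ≤ 1 ∧ ‖θ - I.param‖ ≤ 1 ∧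
    y = deriv I.link (inner ℝ x θ)}

/-- The link function is twice differentiable, with first and second derivatives bounded above
by `L` and `M`. (The first derivative is nonnegative and the second is odd, so these bounds are
also bounds on absolute values.) -/
def LinkSmooth (L M : ℝ) : Prop :=
  Differentiable ℝ I.link ∧ Differentiable ℝ (deriv I.link) ∧
    (∀ x, deriv I.link x ≤ L) ∧ ∀ x, deriv (deriv I.link) x ≤ M

/-- `w` is a probability distribution on pairs whose design matrix is nonsingular. -/
def IsDesign (w : Fin K × Fin K → ℝ) : Prop :=
  (∀ p, 0 ≤ w p) ∧ ∑ p, w p = 1 ∧ (I.designMatrix w).PosDef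

/-- `g(w) = max_{i,j} φ_{i,j}ᵀ V(w)⁻¹ φ_{i,j}`. -/
def designValue (w : Fin K × Fin K → ℝ) : ℝ :=
  ⨆ p : Fin K × Fin K,
    (I.feature p.1 p.2).ofLp ⬝ᵥ ((I.designMatrix w)⁻¹.mulVec (I.feature p.1 p.2).ofLp)

/-- `w` minimizes `g`. Distributions with a singular design matrix have `g = ∞`, hence are left
out of the comparison. -/
def IsGOptimal (w : Fin K × Fin K → ℝ) : Prop :=
  I.IsDesign w ∧ ∀ w', I.IsDesign w' → I.designValue w ≤ I.designValue w'

/-- `θ` solves the likelihood equation `∑ μ(φ_tᵀ θ) φ_t = ∑ r_t φ_t` for the history `h`. -/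
def IsMLE {n : ℕ} (h : DuelHistory K n) (θ : EuclideanSpace ℝ (Fin d)) : Prop :=
  ∑ t, I.link (inner ℝ (I.feature (h t).1.1 (h t).1.2) θ) • I.feature (h t).1.1 (h t).1.2 =
    ∑ t, (if (h t).2 then (1 : ℝ) else 0) • I.feature (h t).1.1 (h t).1.2

/-- The commit step after `n` exploration rounds: a maximum likelihood estimate from the data
(arbitrary on data for which none exists), and an item of maximal estimated Borda score. -/
structure CommitRule (n : ℕ) where
  /-- The estimate of the parameter. -/
  est : DuelHistory K n → EuclideanSpace ℝ (Fin d)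
  est_spec : ∀ h, (∃ θ, I.IsMLE h θ) → I.IsMLE h (est h)
  /-- The item committed to. -/
  arm : DuelHistory K n → Fin K
  arm_spec : ∀ h i, I.bordaAt (est h) i ≤ I.bordaAt (est h) (arm h)

/-- The law of the feedback of a query: `true` with probability `p_{i,j}`. -/
def feedback (p : Fin K × Fin K) : PMF Bool :=
  PMF.ofFintype
    (fun b => ENNReal.ofReal (if b then I.pref p.1 p.2 else 1 - I.pref p.1 p.2)) (by
      have h := I.link_mem p.1 p.2
      have h0 : 0 ≤ I.pref p.1 p.2 := h.1
      have h1 : 0 ≤ 1 - I.pref p.1 p.2 := sub_nonneg.2 h.2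
      simp [← ENNReal.ofReal_add h0 h1])

/-- The law of the first `n` rounds when each pair is drawn from a policy given the history, and
the feedback depends on the history only through the pair queried. -/
def historyLaw (policy : (t : ℕ) → DuelHistory K t → PMF (Fin K × Fin K)) :
    (n : ℕ) → PMF (DuelHistory K n)
  | 0 => PMF.pure Fin.elim0
  | n + 1 => (historyLaw policy n).bind fun h =>
      (policy n h).bind fun p =>
        (I.feedback p).map fun r => Fin.snoc (α := fun _ => (Fin K × Fin K) × Bool) h (p, r)

end GLMDuelingBandit

/-- The queries of the designed exploration in order: for every `i`, for every `j`, the pair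
`(i, j)` is listed `N (i, j)` times. -/
def designSchedule {K : ℕ} (N : Fin K × Fin K → ℕ) : List (Fin K × Fin K) :=
  (List.finRange K).flatMap fun i => (List.finRange K).flatMap fun j =>
    List.replicate (N (i, j)) (i, j)

/-- `N(i,j) = ⌈d w(i,j) / ε²⌉`, which is `0` off the support of `w`. -/
def designCount {K : ℕ} (d : ℕ) (ε : ℝ) (w : Fin K × Fin K → ℝ) (p : Fin K × Fin K) : ℕ :=
  ⌈(d : ℝ) * w p / ε ^ 2⌉₊

/-- The number of exploration rounds: `τ` uniform ones and those of the design. -/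
def explorationLength {K : ℕ} (d τ : ℕ) (ε : ℝ) (w : Fin K × Fin K → ℝ) : ℕ :=
  τ + (designSchedule (designCount d ε w)).length

namespace GLMDuelingBandit

variable {K d : ℕ} (I : GLMDuelingBandit K d)

/-- The policy of explore-then-commit: in the first `τ` rounds the two items are independent and
uniform, then the design is played, then the pair `(î, î)` forever, where `î` is computed from
the exploration rounds. Rounds are numbered from `0`. -/
def betcPolicy [NeZero K] (τ : ℕ) (ε : ℝ) (w : Fin K × Fin K → ℝ)
    (rule : I.CommitRule (explorationLength d τ ε w)) (t : ℕ) (h : DuelHistory K t) :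
    PMF (Fin K × Fin K) :=
  if ht : t < τ then
    (PMF.uniformOfFintype (Fin K)).bind fun i => (PMF.uniformOfFintype (Fin K)).map fun j => (i, j)
  else if hs : t - τ < (designSchedule (designCount d ε w)).length then
    PMF.pure ((designSchedule (designCount d ε w))[t - τ])
  else
    have hn : explorationLength d τ ε w ≤ t := by unfold explorationLength; omega
    PMF.pure (rule.arm fun s => h (Fin.castLE hn s), rule.arm fun s => h (Fin.castLE hn s))

/-- The law of the history of the first `T` rounds of explore-then-commit. If exploration takes
more than `T` rounds, the run ends during exploration. -/
def betcLaw [NeZero K] (τ : ℕ) (ε : ℝ) (w : Fin K × Fin K → ℝ)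
    (rule : I.CommitRule (explorationLength d τ ε w)) (T : ℕ) :
    MeasureTheory.Measure (DuelHistory K T) :=
  (I.historyLaw (I.betcPolicy τ ε w rule) T).toMeasure

end GLMDuelingBandit

/-- `τ = C₄ λ₀⁻² (d + log(1/δ))`, rounded up. -/
def uniformRounds (C₄ lam : ℝ) (d : ℕ) (δ : ℝ) : ℕ :=
  ⌈C₄ * (lam ^ 2)⁻¹ * ((d : ℝ) + Real.log (1 / δ))⌉₊

/-- `ε = d^{1/6} T^{-1/3}`. -/
def designAccuracy (d T : ℕ) : ℝ := (d : ℝ) ^ (1 / 6 : ℝ) * (T : ℝ) ^ (-(1 / 3) : ℝ)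

end

/-! Explore-then-commit pays at most 2 per exploration round and then a fixed gap in every later
round. Write `P = d^(2/3) T^(2/3)`. The design uses about `d / ε²` rounds, which is exactly `P` for
the chosen `ε`, and the gap over `T` rounds costs a multiple of `κ⁻¹ T ε √d = κ⁻¹ P`, up to a
logarithm.

Three ingredients give the gap. By the Kiefer–Wolfowitz theorem a G-optimal design has value `d`, so
after the design rounds every feature satisfies `⟪φ, u⟫² ≤ ε² Q(u)`, where `Q` is the Gram form of
the queries (`IsGOptimal.inner_sq_le_gram`). The exploration queries do not depend on the feedback,
so the noise is a sum of independent terms given the queries, and its norm dual to `Q` is at most `β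
= √(d log (2/δ))` with probability at least `1 - δ` (`historyLaw_noisyHistories_le`). Monotonicity
of the link, with slope at least `κ` near `θ⋆`, then gives existence of the maximum likelihood
estimate and `Q(θ̂ - θ⋆) ≤ β²/κ²` (`exists_likelihood_solution`, `likelihood_solution_close`). Hence
all predictions err by at most `εβ/κ`, and the gap is at most `4Lεβ/κ`.

The likelihood argument needs `β² < κ² Q(u)` on unit vectors. Feature regularity combined with the
design bound gives `Q(u) ≥ λ₀/ε²`, so `β²ε² < κ²λ₀` suffices. If this fails, the claimed bound
already exceeds the trivial bound `2T`. Thus the lower bound on `Q` comes from the design rounds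
alone; the uniform rounds only add to `Q` and to the cost. -/

noncomputable section

/-! ### Optimal designs: the Kiefer–Wolfowitz theorem with a support bound. -/

namespace OptimalDesign

open Matrix Finset

variable {ι : Type*} [Fintype ι] {d : ℕ}

/-- The moment matrix `∑ w p • v p (v p)ᵀ` of a weighting of a finite family of vectors. -/
def moment (v : ι → Fin d → ℝ) (w : ι → ℝ) : Matrix (Fin d) (Fin d) ℝ :=
  ∑ p, w p • vecMulVec (v p) (v p)

/-- The variance function `xᵀ V(w)⁻¹ x`. -/
def variance (v : ι → Fin d → ℝ) (w : ι → ℝ) (x : Fin d → ℝ) : ℝ :=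
  x ⬝ᵥ ((moment v w)⁻¹ *ᵥ x)

theorem vecMulVec_mulVec_self (x u : Fin d → ℝ) :
    vecMulVec x x *ᵥ u = (x ⬝ᵥ u) • x := by
  ext i
  simp [vecMulVec, mulVec, dotProduct, Finset.mul_sum, mul_comm, mul_left_comm]

theorem dotProduct_moment_mulVec (v : ι → Fin d → ℝ) (w : ι → ℝ) (u : Fin d → ℝ) :
    u ⬝ᵥ (moment v w *ᵥ u) = ∑ p, w p * (v p ⬝ᵥ u) ^ 2 := by
  unfold moment
  rw [Matrix.sum_mulVec, dotProduct_sum]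
  refine Finset.sum_congr rfl fun p _ => ?_
  rw [smul_mulVec, vecMulVec_mulVec_self, dotProduct_smul, dotProduct_smul, dotProduct_comm u]
  simp only [smul_eq_mul]
  ring

theorem moment_isHermitian (v : ι → Fin d → ℝ) (w : ι → ℝ) : (moment v w).IsHermitian := by
  ext i j
  simp [moment, Matrix.sum_apply, vecMulVec, mul_comm]

theorem moment_posSemidef (v : ι → Fin d → ℝ) {w : ι → ℝ} (hw : ∀ p, 0 ≤ w p) :
    (moment v w).PosSemidef := by
  refine PosSemidef.of_dotProduct_mulVec_nonneg (moment_isHermitian v w) fun u => ?_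
  rw [star_trivial, dotProduct_moment_mulVec]
  exact Finset.sum_nonneg fun p _ => mul_nonneg (hw p) (sq_nonneg _)

/-- The Cauchy–Schwarz inequality between a positive definite form and its inverse. -/
theorem sq_dotProduct_le {A : Matrix (Fin d) (Fin d) ℝ} (hA : A.PosDef) (x u : Fin d → ℝ) :
    (x ⬝ᵥ u) ^ 2 ≤ (x ⬝ᵥ (A⁻¹ *ᵥ x)) * (u ⬝ᵥ (A *ᵥ u)) := by
  set y := A⁻¹ *ᵥ x with hy
  have hdet : IsUnit A.det := hA.det_pos.ne'.isUnit
  have hAy : A *ᵥ y = x := by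
    rw [hy, mulVec_mulVec, Matrix.mul_nonsing_inv _ hdet, one_mulVec]
  have hsymm : ∀ a b : Fin d → ℝ, a ⬝ᵥ (A *ᵥ b) = b ⬝ᵥ (A *ᵥ a) := fun a b => by
    have hT : Aᵀ = A := by simpa using hA.1.eq
    rw [dotProduct_mulVec, dotProduct_comm]
    nth_rewrite 1 [← hT]
    rw [vecMul_transpose]
  have hquad : ∀ t : ℝ, 0 ≤ (x ⬝ᵥ y) * (t * t) + (-2 * (x ⬝ᵥ u)) * t + u ⬝ᵥ (A *ᵥ u) := fun t => by
    have h := hA.posSemidef.dotProduct_mulVec_nonneg (u - t • y)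
    rw [star_trivial] at h
    simp only [mulVec_sub, mulVec_smul, hAy, sub_dotProduct, dotProduct_sub, smul_dotProduct,
      dotProduct_smul, smul_eq_mul] at h
    have h1 : y ⬝ᵥ (A *ᵥ u) = x ⬝ᵥ u := by rw [hsymm, hAy, dotProduct_comm]
    rw [h1, dotProduct_comm u x, dotProduct_comm y x] at h
    linarith
  have := discrim_le_zero hquad
  unfold discrim at this
  linarith

/-- The sum is the trace of `V⁻¹ V`. It bounds the value of every design below by `d`, and forces
equality on the support of an optimal one. -/
theorem sum_mul_variance (v : ι → Fin d → ℝ) {w : ι → ℝ} (hV : (moment v w).PosDef) :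
    ∑ p, w p * variance v w (v p) = d := by
  have hdet : IsUnit (moment v w).det := hV.det_pos.ne'.isUnit
  have h : ((moment v w)⁻¹ * moment v w).trace = d := by
    rw [Matrix.nonsing_inv_mul _ hdet]; simp
  rw [← h]
  conv_rhs => rw [moment.eq_def v w]
  rw [Matrix.mul_sum, Matrix.trace_sum]
  refine Finset.sum_congr rfl fun p _ => ?_
  rw [Matrix.mul_smul, Matrix.trace_smul, Matrix.mul_vecMulVec, Matrix.trace_vecMulVec,
    dotProduct_comm, smul_eq_mul]
  rfl

/-- Along the segment from a positive definite matrix to a rank-one matrix. -/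
theorem det_segment_rank_one {A : Matrix (Fin d) (Fin d) ℝ} (hA : IsUnit A.det) (x : Fin d → ℝ)
    {t : ℝ} (ht : t ≠ 1) :
    ((1 - t) • A + t • vecMulVec x x).det =
      (1 - t) ^ d * A.det * (1 + t / (1 - t) * (x ⬝ᵥ (A⁻¹ *ᵥ x))) := by
  have h1 : (1 - t) ≠ 0 := sub_ne_zero.2 ht.symm
  have hB : ((1 - t) • A).det = (1 - t) ^ d * A.det := by simp
  have hBu : IsUnit ((1 - t) • A).det := by
    rw [hB]; exact ((isUnit_iff_ne_zero.2 h1).pow d).mul hA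
  have hinv : ((1 - t) • A)⁻¹ = (1 - t)⁻¹ • A⁻¹ := by
    refine Matrix.inv_eq_right_inv ?_
    rw [Matrix.smul_mul, Matrix.mul_smul, smul_smul, mul_inv_cancel₀ h1, one_smul,
      Matrix.mul_nonsing_inv _ hA]
  have hv : t • vecMulVec x x = replicateCol Unit (t • x) * replicateRow Unit x := by
    ext i j
    simp [vecMulVec, Matrix.mul_apply, mul_assoc]
  rw [hv, det_add_replicateCol_mul_replicateRow hBu, hB, hinv]
  congr 1
  simp [Matrix.det_unique, Matrix.mul_apply, dotProduct, mulVec, Finset.mul_sum, Finset.sum_mul]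
  rw [Finset.sum_comm]
  refine Finset.sum_congr rfl fun i _ => Finset.sum_congr rfl fun j _ => ?_
  field_simp

/-- Bernoulli-type consequence of maximality of the determinant. -/
theorem le_of_forall_pow_mul_le {n : ℕ} {q : ℝ}
    (h : ∀ t : ℝ, 0 < t → t < 1 → (1 - t) ^ n * (1 + t / (1 - t) * q) ≤ 1) : q ≤ n := by
  by_contra! hq
  have hq0 : 0 < q := lt_of_le_of_lt (Nat.cast_nonneg n) hq
  -- choose `t` small and use `(1 - t) ^ n ≥ 1 - n t`
  set t : ℝ := (q - n) / (2 * (n + 1) * (q + 1)) with ht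
  have hn : (0 : ℝ) ≤ n := Nat.cast_nonneg n
  have ht0 : 0 < t := by apply div_pos <;> [linarith; positivity]
  have ht1 : t < 1 := by
    rw [ht, div_lt_one (by positivity)]
    nlinarith
  have h1 := h t ht0 ht1
  have hb : 1 - n * t ≤ (1 - t) ^ n := by
    have := one_add_mul_le_pow (a := -t) (by linarith) n
    have e : (1 + -t) = 1 - t := by ring
    rw [e] at this; linarith
  have h2 : 1 + t * q ≤ 1 + t / (1 - t) * q := by
    have : t ≤ t / (1 - t) := by
      rw [le_div_iff₀ (by linarith)]; nlinarith
    nlinarith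
  have hnt : n * t < (q - n) / q := by
    rw [ht, ← mul_div_assoc, div_lt_div_iff₀ (by positivity) hq0]
    have : n * q < 2 * (n + 1) * (q + 1) := by nlinarith
    nlinarith [mul_lt_mul_of_pos_left this (sub_pos.2 hq)]
  -- The product is `1 + t (q - n - n t q)`, and `t` was chosen so that `n t q < q - n`.
  have h3 : 1 < (1 - n * t) * (1 + t * q) := by
    have : n * t * q < q - n := by rwa [lt_div_iff₀ hq0] at hnt
    nlinarith
  have h4 : (1 - n * t) * (1 + t * q) ≤ (1 - t) ^ n * (1 + t / (1 - t) * q) := by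
    refine mul_le_mul hb h2 (by positivity) (pow_nonneg (by linarith) _)
  linarith

theorem moment_segment [DecidableEq ι] (v : ι → Fin d → ℝ) (w : ι → ℝ) (p : ι) (t : ℝ) :
    moment v ((1 - t) • w + t • Pi.single p 1) =
      (1 - t) • moment v w + t • vecMulVec (v p) (v p) := by
  unfold moment
  simp only [Pi.add_apply, Pi.smul_apply, smul_eq_mul, add_smul, Finset.sum_add_distrib,
    Finset.smul_sum, smul_smul, Pi.single_apply]
  congr 1
  rw [Finset.sum_eq_single p] <;> simp +contextual

/-- A maximizer of the determinant has variance function at most `d` (Kiefer–Wolfowitz). -/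
theorem variance_le_of_isMaxOn {v : ι → Fin d → ℝ} {w : ι → ℝ} (hw : w ∈ stdSimplex ℝ ι)
    (hmax : IsMaxOn (fun w => (moment v w).det) (stdSimplex ℝ ι) w) (hV : (moment v w).PosDef)
    (p : ι) : variance v w (v p) ≤ d := by
  classical
  -- Moving mass `t` onto `p` cannot increase the determinant; to first order in `t` its relative
  -- change is `variance - d`.
  refine le_of_forall_pow_mul_le fun t ht0 ht1 => ?_
  have hmem : (1 - t) • w + t • Pi.single p 1 ∈ stdSimplex ℝ ι :=
    convex_stdSimplex ℝ ι hw (single_mem_stdSimplex ℝ p) (by linarith) ht0.le (by ring)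
  have h := hmax hmem
  simp only [Set.mem_ofPred_eq] at h
  have hdet := hV.det_pos
  rw [moment_segment, det_segment_rank_one hdet.ne'.isUnit _ ht1.ne] at h
  have : (moment v w).det * ((1 - t) ^ d * (1 + t / (1 - t) * variance v w (v p))) ≤
      (moment v w).det * 1 := by
    rw [mul_one]; refine le_trans (le_of_eq ?_) h; unfold variance; ring
  exact le_of_mul_le_mul_left this hdet

/-- The determinant attains its maximum on the compact simplex; `w₀` shows that this maximum is
positive, so that the maximizer is nonsingular. -/
theorem exists_variance_le {v : ι → Fin d → ℝ} {w₀ : ι → ℝ} (hw₀ : w₀ ∈ stdSimplex ℝ ι)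
    (hV₀ : (moment v w₀).PosDef) :
    ∃ w ∈ stdSimplex ℝ ι, (moment v w).PosDef ∧ ∀ p, variance v w (v p) ≤ d := by
  have hcont : Continuous fun w : ι → ℝ => (moment v w).det := by
    unfold moment
    fun_prop
  obtain ⟨w, hw, hmax⟩ := (isCompact_stdSimplex ℝ ι).exists_isMaxOn ⟨w₀, hw₀⟩ hcont.continuousOn
  have hpos : 0 < (moment v w).det := lt_of_lt_of_le hV₀.det_pos (hmax hw₀)
  have hV : (moment v w).PosDef :=
    (moment_posSemidef v hw.1).posDef_iff_det_ne_zero.2 hpos.ne'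
  exact ⟨w, hw, hV, variance_le_of_isMaxOn hw hmax hV⟩

/-- The entries of `x xᵀ` on and above the diagonal. -/
def symSquare (x : Fin d → ℝ) : Sym2 (Fin d) → ℝ :=
  Sym2.lift ⟨fun i j => x i * x j, fun i j => mul_comm (x i) (x j)⟩

/-- If the support is too large, the weights can be moved without changing the moment matrix. -/
theorem exists_moment_eq_zero (v : ι → Fin d → ℝ) (S : Finset ι) (hS : d * (d + 1) / 2 < S.card) :
    ∃ c : ι → ℝ, (∀ p ∉ S, c p = 0) ∧ (∃ p, c p ≠ 0) ∧ moment v c = 0 := by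
  classical
  -- The entries indexed by `Sym2 (Fin d)` describe a symmetric matrix, a space of dimension `d (d +
  -- 1) / 2`.
  have hdep : ¬ LinearIndependent ℝ (fun p : S => symSquare (v p)) := fun h => by
    have := h.fintype_card_le_finrank
    rw [Module.finrank_fintype_fun_eq_card, Sym2.card, Fintype.card_fin, Fintype.card_coe,
      Nat.choose_two_right, Nat.add_sub_cancel, mul_comm] at this
    omega
  obtain ⟨g, hg, p₀, hp₀⟩ := Fintype.not_linearIndependent_iff.1 hdep
  refine ⟨fun p => if h : p ∈ S then g ⟨p, h⟩ else 0, fun p hp => by simp [hp],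
    ⟨p₀, by simpa using hp₀⟩, ?_⟩
  ext i j
  have h := congrFun hg s(i, j)
  simp only [Finset.sum_apply, Pi.smul_apply, symSquare, Sym2.lift_mk, smul_eq_mul,
    Pi.zero_apply] at h
  simp only [moment, Matrix.sum_apply, Matrix.smul_apply, vecMulVec_apply, smul_eq_mul,
    Matrix.zero_apply]
  refine Eq.trans ?_ h
  rw [← Finset.sum_subset (Finset.subset_univ S), ← Finset.sum_coe_sort S]
  · refine Finset.sum_congr rfl fun p _ => by simp
  · intro p _ hp; simp [hp]

/-- Moving nonnegative weights along a direction of zero sum until one of them vanishes. -/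
theorem exists_add_smul_support_ssubset {w c : ι → ℝ} (hw : ∀ p, 0 ≤ w p)
    (hc : ∀ p, w p = 0 → c p = 0) (hne : ∃ p, c p ≠ 0) (hsum : ∑ p, c p = 0) :
    ∃ t : ℝ, (∀ p, 0 ≤ (w + t • c) p) ∧
      Function.support (w + t • c) ⊂ Function.support w := by
  have hneg : ∃ p, c p < 0 := by
    by_contra! h
    obtain ⟨p, hp⟩ := hne
    exact hp ((Finset.sum_eq_zero_iff_of_nonneg fun p _ => h p).1 hsum p (Finset.mem_univ p))
  -- Ratio test: among the decreasing weights, `q` is the first to reach zero.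
  obtain ⟨q, hq, hmin⟩ := Finset.exists_min_image (Finset.univ.filter fun p => c p < 0)
    (fun p => w p / -c p) (by obtain ⟨p, hp⟩ := hneg; exact ⟨p, by simpa using hp⟩)
  have hq' : c q < 0 := by simpa using hq
  refine ⟨w q / -c q, fun p => ?_, ?_⟩
  · simp only [Pi.add_apply, Pi.smul_apply, smul_eq_mul]
    have ht0 : 0 ≤ w q / -c q := div_nonneg (hw q) (by linarith)
    rcases le_or_gt 0 (c p) with hp | hp
    · exact add_nonneg (hw p) (mul_nonneg ht0 hp)
    · have := hmin p (by simpa using hp)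
      rw [le_div_iff₀ (by linarith)] at this
      linarith
  · rw [Set.ssubset_iff_of_subset]
    · refine ⟨q, ?_, ?_⟩
      · exact fun h => hq'.ne (hc q h)
      · have : c q ≠ 0 := hq'.ne
        simp only [Function.mem_support, Pi.add_apply, Pi.smul_apply, smul_eq_mul, ne_eq, not_not]
        field_simp
        ring
    · intro p hp h0
      exact hp (by simp [h0, hc p h0])

theorem moment_add_smul (v : ι → Fin d → ℝ) (w c : ι → ℝ) (t : ℝ) :
    moment v (w + t • c) = moment v w + t • moment v c := by
  simp [moment, add_smul, Finset.sum_add_distrib, Finset.smul_sum, smul_smul]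

/-- The variance function of a design with variance at most `d` equals `d` on the support. -/
theorem variance_eq_of_mem_support {v : ι → Fin d → ℝ} {w : ι → ℝ} (hw : w ∈ stdSimplex ℝ ι)
    (hV : (moment v w).PosDef) (hle : ∀ p, variance v w (v p) ≤ d) {p : ι} (hp : w p ≠ 0) :
    variance v w (v p) = d := by
  have h : ∑ p, w p * (d - variance v w (v p)) = 0 := by
    simp only [mul_sub, Finset.sum_sub_distrib, sum_mul_variance v hV, ← Finset.sum_mul, hw.2]
    ring
  have := (Finset.sum_eq_zero_iff_of_nonneg fun p _ =>
    mul_nonneg (hw.1 p) (sub_nonneg.2 (hle p))).1 h p (Finset.mem_univ p)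
  rcases mul_eq_zero.1 this with h | h
  · exact absurd h hp
  · linarith

/-- An optimal design of support at most `d (d + 1) / 2`. -/
theorem exists_variance_le_ncard_support_le (hd : d ≠ 0) {v : ι → Fin d → ℝ} {w₀ : ι → ℝ}
    (hw₀ : w₀ ∈ stdSimplex ℝ ι) (hV₀ : (moment v w₀).PosDef) :
    ∃ w ∈ stdSimplex ℝ ι, (moment v w).PosDef ∧ (∀ p, variance v w (v p) ≤ d) ∧
      (Function.support w).ncard ≤ d * (d + 1) / 2 := by
  classical
  -- Take a design of minimal support; a larger support than claimed would allow a further reduction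
  -- with the same moment matrix.
  let P : ℕ → Prop := fun n => ∃ w ∈ stdSimplex ℝ ι, (moment v w).PosDef ∧
    (∀ p, variance v w (v p) ≤ d) ∧ (Function.support w).ncard = n
  have hP : ∃ n, P n := by
    obtain ⟨w, h1, h2, h3⟩ := exists_variance_le hw₀ hV₀
    exact ⟨_, w, h1, h2, h3, rfl⟩
  obtain ⟨w, hw, hV, hle, hcard⟩ := Nat.find_spec hP
  refine ⟨w, hw, hV, hle, ?_⟩
  by_contra! hlt
  obtain ⟨c, hc0, hne, hmom⟩ := exists_moment_eq_zero v (Function.support w).toFinset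
    (by rwa [← Set.ncard_eq_toFinset_card'])
  have hc0' : ∀ p, w p = 0 → c p = 0 := fun p hp => hc0 p (by simpa using hp)
  -- Conservation of mass is automatic: the variance is `d` on the support, so the trace of `V⁻¹ *
  -- moment v c = 0` equals `d ∑ c`. This saves the extra point of Carathéodory's theorem.
  have hsum : ∑ p, c p = 0 := by
    have h : ∑ p, c p * variance v w (v p) = 0 := by
      have h : ((moment v w)⁻¹ * moment v c).trace = 0 := by rw [hmom]; simp
      rw [← h, moment.eq_def v c, Matrix.mul_sum, Matrix.trace_sum]
      refine Finset.sum_congr rfl fun p _ => ?_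
      rw [Matrix.mul_smul, Matrix.trace_smul, Matrix.mul_vecMulVec, Matrix.trace_vecMulVec,
        dotProduct_comm, smul_eq_mul]
      rfl
    have h' : ∑ p, c p * variance v w (v p) = (∑ p, c p) * d := by
      rw [Finset.sum_mul]
      refine Finset.sum_congr rfl fun p _ => ?_
      by_cases hp : w p = 0
      · simp [hc0' p hp]
      · rw [variance_eq_of_mem_support hw hV hle hp]
    rw [h'] at h
    exact (mul_eq_zero.1 h).resolve_right (by exact_mod_cast hd)
  obtain ⟨t, ht0, hss⟩ := exists_add_smul_support_ssubset hw.1 hc0' hne hsum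
  have hmeq : moment v (w + t • c) = moment v w := by simp [moment_add_smul, hmom]
  have hPn : P (Function.support (w + t • c)).ncard := by
    refine ⟨w + t • c, ⟨ht0, ?_⟩, by rwa [hmeq], fun p => ?_, rfl⟩
    · simp only [Pi.add_apply, Pi.smul_apply, smul_eq_mul, Finset.sum_add_distrib,
        ← Finset.mul_sum, hsum, hw.2]
      ring
    · unfold variance; rw [hmeq]; exact hle p
  have := Nat.find_min' hP hPn
  have h2 := Set.ncard_lt_ncard hss (Set.toFinite _)
  omega

end OptimalDesign
end

noncomputable section

/-! ### Existence and accuracy of solutions of the likelihood equation. -/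

section LikelihoodEquation

variable {E : Type*} [NormedAddCommGroup E] [InnerProductSpace ℝ E]
  {ι : Type*} [Fintype ι]

/-- The first derivative is at least `κ` at all inner products of a vector of the unit ball with a
point of the unit ball around `θ₀`. -/
def SlopeBound (μ : ℝ → ℝ) (θ₀ : E) (κ : ℝ) : Prop :=
  ∀ x θ : E, ‖x‖ ≤ 1 → ‖θ - θ₀‖ ≤ 1 → κ ≤ deriv μ (inner ℝ x θ)

/-- Mean value theorem on the segment from `θ₀` to `θ₀ + u`, which stays in the unit ball where the
slope bound is available. -/
theorem SlopeBound.mul_sq_le {μ : ℝ → ℝ} {θ₀ : E} {κ : ℝ} (h : SlopeBound μ θ₀ κ)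
    (hμ : Differentiable ℝ μ) {x u : E} (hx : ‖x‖ ≤ 1) (hu : ‖u‖ ≤ 1) :
    κ * inner ℝ x u ^ 2 ≤
      (μ (inner ℝ x (θ₀ + u)) - μ (inner ℝ x θ₀)) * inner ℝ x u := by
  set g : ℝ → ℝ := fun s => μ (inner ℝ x θ₀ + s * inner ℝ x u) * inner ℝ x u with hg
  have hd : ∀ s, HasDerivAt g (deriv μ (inner ℝ x θ₀ + s * inner ℝ x u) * inner ℝ x u *
      inner ℝ x u) s := fun s => by
    have h1 : HasDerivAt (fun s : ℝ => inner ℝ x θ₀ + s * inner ℝ x u) (inner ℝ x u) s := by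
      simpa using ((hasDerivAt_id s).mul_const (inner ℝ x u)).const_add (inner ℝ x θ₀)
    exact ((hμ _).hasDerivAt.comp s h1).mul_const _
  obtain ⟨c, hc, hc'⟩ := exists_hasDerivAt_eq_slope g _ (zero_lt_one' ℝ)
    (fun s _ => (hd s).continuousAt.continuousWithinAt) (fun s _ => hd s)
  have h2 : κ ≤ deriv μ (inner ℝ x θ₀ + c * inner ℝ x u) := by
    have := h x (θ₀ + c • u) hx (by
      rw [add_sub_cancel_left, norm_smul, Real.norm_eq_abs, abs_of_pos hc.1]
      exact mul_le_one₀ hc.2.le (norm_nonneg _) hu)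
    rwa [inner_add_right, inner_smul_right] at this
  have h3 : g 1 - g 0 = (μ (inner ℝ x (θ₀ + u)) - μ (inner ℝ x θ₀)) * inner ℝ x u := by
    simp [hg, inner_add_right, sub_mul]
  rw [sub_zero, div_one, h3] at hc'
  rw [← hc', mul_assoc, ← sq]
  exact mul_le_mul_of_nonneg_right h2 (sq_nonneg _)

/-- Pulls a distant parameter back to the unit sphere around `θ₀`, where the slope bound applies,
without increasing the product. -/
theorem Monotone.sub_mul_le_of_one_le {μ : ℝ → ℝ} (hμ : Monotone μ) (a b : ℝ) {ρ : ℝ}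
    (hρ : 1 ≤ ρ) : (μ (a + b) - μ a) * b ≤ (μ (a + ρ * b) - μ a) * b := by
  rcases le_total 0 b with hb | hb
  · exact mul_le_mul_of_nonneg_right (sub_le_sub_right (hμ (by nlinarith)) _) hb
  · exact mul_le_mul_of_nonpos_right (sub_le_sub_right (hμ (by nlinarith)) _) hb

variable {μ : ℝ → ℝ} {θ₀ : E} {κ β : ℝ} {x : ι → E} {r : ι → ℝ}

/-- Every solution of the likelihood equation is close to the true parameter. -/
theorem likelihood_solution_close (hmono : Monotone μ) (hμ : Differentiable ℝ μ)
    (hκ : SlopeBound μ θ₀ κ) (hκ0 : 0 < κ) (hx : ∀ t, ‖x t‖ ≤ 1)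
    (hZ : ∀ u, inner ℝ (∑ t, (r t - μ (inner ℝ (x t) θ₀)) • x t) u ^ 2 ≤
      β ^ 2 * ∑ t, inner ℝ (x t) u ^ 2)
    (hQ : ∀ u : E, ‖u‖ = 1 → β ^ 2 < κ ^ 2 * ∑ t, inner ℝ (x t) u ^ 2) {θ : E}
    (hθ : 0 ≤ inner ℝ (∑ t, (r t - μ (inner ℝ (x t) θ)) • x t) (θ - θ₀)) :
    ‖θ - θ₀‖ < 1 ∧ κ ^ 2 * ∑ t, inner ℝ (x t) (θ - θ₀) ^ 2 ≤ β ^ 2 := by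
  -- With `Q(u)` the sum of squares and `Z` the noise, `κ Q ≤ ⟪Z, u⟫` and `⟪Z, u⟫² ≤ β² Q` give `κ²
  -- Q² ≤ β² Q`; cancel `Q`.
  have key : ∀ u : E, κ * ∑ t, inner ℝ (x t) u ^ 2 ≤
      inner ℝ (∑ t, (r t - μ (inner ℝ (x t) θ₀)) • x t) u →
      κ ^ 2 * ∑ t, inner ℝ (x t) u ^ 2 ≤ β ^ 2 := fun u hu => by
    have h0 : 0 ≤ ∑ t, inner ℝ (x t) u ^ 2 := Finset.sum_nonneg fun t _ => sq_nonneg _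
    rcases h0.eq_or_lt with h0 | h0
    · rw [← h0, mul_zero]; positivity
    · have h1 := hZ u
      have h2 := pow_le_pow_left₀ (by positivity) hu 2
      have h3 : (κ ^ 2 * ∑ t, inner ℝ (x t) u ^ 2) * ∑ t, inner ℝ (x t) u ^ 2 ≤
          β ^ 2 * ∑ t, inner ℝ (x t) u ^ 2 := by
        refine le_trans (le_of_eq ?_) (h2.trans h1); ring
      exact le_of_mul_le_mul_right h3 h0
  have hsplit : ∀ u : E, inner ℝ (∑ t, (r t - μ (inner ℝ (x t) θ₀)) • x t) u =
      inner ℝ (∑ t, (r t - μ (inner ℝ (x t) θ)) • x t) u +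
      ∑ t, (μ (inner ℝ (x t) θ) - μ (inner ℝ (x t) θ₀)) * inner ℝ (x t) u := fun u => by
    simp only [sum_inner, inner_smul_left, ← Finset.sum_add_distrib]
    refine Finset.sum_congr rfl fun t _ => ?_
    simp only [conj_trivial]
    ring
  have hle : ‖θ - θ₀‖ ≤ 1 := by
    -- Beyond distance 1, the normalized direction would satisfy the premise of `key`, contradicting
    -- `hQ` on unit vectors.
    by_contra! hlt
    set ρ := ‖θ - θ₀‖ with hρ
    have hρ0 : 0 < ρ := by linarith
    set u := ρ⁻¹ • (θ - θ₀) with hu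
    have hw : θ - θ₀ = ρ • u := by rw [hu, smul_smul, mul_inv_cancel₀ hρ0.ne', one_smul]
    have hnu : ‖u‖ = 1 := by
      rw [hu, norm_smul, norm_inv, Real.norm_eq_abs, abs_of_pos hρ0, ← hρ,
        inv_mul_cancel₀ hρ0.ne']
    have hθ' : 0 ≤ inner ℝ (∑ t, (r t - μ (inner ℝ (x t) θ)) • x t) u := by
      rw [hu, inner_smul_right]
      exact mul_nonneg (inv_nonneg.2 hρ0.le) hθ
    refine absurd (key u ?_) (not_le.2 (hQ u hnu))
    rw [hsplit, Finset.mul_sum]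
    refine le_add_of_nonneg_of_le hθ' (Finset.sum_le_sum fun t _ => ?_)
    refine (hκ.mul_sq_le hμ (hx t) hnu.le).trans ?_
    have h1 : inner ℝ (x t) θ = inner ℝ (x t) θ₀ + ρ * inner ℝ (x t) u := by
      rw [← inner_smul_right, ← hw, ← inner_add_right, add_sub_cancel]
    rw [h1, inner_add_right]
    exact hmono.sub_mul_le_of_one_le _ _ hlt.le
  have hcl := key (θ - θ₀) (by
    rw [hsplit, Finset.mul_sum]
    refine le_add_of_nonneg_of_le hθ (Finset.sum_le_sum fun t _ => ?_)
    simpa using hκ.mul_sq_le hμ (hx t) hle)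
  refine ⟨lt_of_le_of_ne hle fun h => ?_, hcl⟩
  exact absurd hcl (not_le.2 (hQ _ h))

theorem hasFDerivAt_likelihood (hμ : Continuous μ) (x : ι → E) (r : ι → ℝ) (θ : E) :
    HasFDerivAt (fun θ : E => ∑ t, ((∫ s in (0 : ℝ)..inner ℝ (x t) θ, μ s) -
        r t * inner ℝ (x t) θ))
      (innerSL ℝ (∑ t, (μ (inner ℝ (x t) θ) - r t) • x t)) θ := by
  have h : ∀ t, HasFDerivAt (fun θ : E => (∫ s in (0 : ℝ)..inner ℝ (x t) θ, μ s) -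
      r t * inner ℝ (x t) θ) ((μ (inner ℝ (x t) θ) - r t) • innerSL ℝ (x t)) θ := fun t => by
    have h1 : HasDerivAt (fun s : ℝ => (∫ s in (0 : ℝ)..s, μ s) - r t * s)
        (μ (inner ℝ (x t) θ) - r t) (inner ℝ (x t) θ) := by
      simpa using (hμ.integral_hasStrictDerivAt 0 _).hasDerivAt.fun_sub
        ((hasDerivAt_id (inner ℝ (x t) θ)).const_mul (r t))
    exact h1.comp_hasFDerivAt θ (innerSL ℝ (x t)).hasFDerivAt
  have := HasFDerivAt.fun_sum (u := Finset.univ) fun t _ => h t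
  refine this.congr_fderiv ?_
  simp [map_sum, map_smul]

/-- The likelihood equation has a solution. -/
theorem exists_likelihood_solution [FiniteDimensional ℝ E] (hmono : Monotone μ)
    (hμ : Differentiable ℝ μ)
    (hκ : SlopeBound μ θ₀ κ) (hκ0 : 0 < κ) (hx : ∀ t, ‖x t‖ ≤ 1)
    (hZ : ∀ u, inner ℝ (∑ t, (r t - μ (inner ℝ (x t) θ₀)) • x t) u ^ 2 ≤
      β ^ 2 * ∑ t, inner ℝ (x t) u ^ 2)
    (hQ : ∀ u : E, ‖u‖ = 1 → β ^ 2 < κ ^ 2 * ∑ t, inner ℝ (x t) u ^ 2) :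
    ∃ θ : E, ∑ t, (r t - μ (inner ℝ (x t) θ)) • x t = 0 := by
  have : ProperSpace E := FiniteDimensional.proper ℝ E
  have hF := hasFDerivAt_likelihood hμ.continuous x r
  -- Minimize the negative log-likelihood over the closed unit ball around `θ₀`; the aim is to show
  -- that the minimizer is interior.
  obtain ⟨θ, hθ, hmin⟩ := (isCompact_closedBall θ₀ 1).exists_isMinOn
    ⟨θ₀, Metric.mem_closedBall_self zero_le_one⟩
    (continuous_iff_continuousAt.2 fun θ => (hF θ).continuousAt).continuousOn
  have hneg : ∀ u, inner ℝ (∑ t, (μ (inner ℝ (x t) θ) - r t) • x t) u =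
      - inner ℝ (∑ t, (r t - μ (inner ℝ (x t) θ)) • x t) u := fun u => by
    rw [← inner_neg_left, ← Finset.sum_neg_distrib]
    simp only [← neg_smul, neg_sub]
  -- First-order condition towards `θ₀`. This sign is all that `likelihood_solution_close` requires,
  -- so it applies before the gradient is known to vanish.
  have h1 : 0 ≤ inner ℝ (∑ t, (r t - μ (inner ℝ (x t) θ)) • x t) (θ - θ₀) := by
    have := hmin.localize.hasFDerivWithinAt_nonneg (hF θ).hasFDerivWithinAt
      (sub_mem_posTangentConeAt_of_segment_subset ((convex_closedBall θ₀ 1).segment_subset hθ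
        (Metric.mem_closedBall_self zero_le_one)))
    rw [innerSL_apply_apply, hneg, ← inner_neg_right, neg_sub] at this
    exact this
  obtain ⟨h2, -⟩ := likelihood_solution_close hmono hμ hκ hκ0 hx hZ hQ h1
  have h3 : IsLocalMin _ θ := hmin.isLocalMin (Metric.closedBall_mem_nhds_of_mem
    (by rwa [Metric.mem_ball, dist_eq_norm]))
  have h4 := h3.hasFDerivAt_eq_zero (hF θ)
  refine ⟨θ, ext_inner_right ℝ fun u => ?_⟩
  have := congrArg (fun f => f u) h4
  simp only [innerSL_apply_apply, hneg] at this
  simpa using this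

end LikelihoodEquation

/-! ### G-optimal designs of the bandit. -/

namespace GLMDuelingBandit

open OptimalDesign Matrix

variable {K d : ℕ} (I : GLMDuelingBandit K d)

/-- The feature vectors in coordinates. -/
def featureCoords (p : Fin K × Fin K) : Fin d → ℝ := (I.feature p.1 p.2).ofLp

theorem designMatrix_eq_moment (w : Fin K × Fin K → ℝ) :
    I.designMatrix w = moment I.featureCoords w := rfl

theorem designValue_eq (w : Fin K × Fin K → ℝ) :
    I.designValue w = ⨆ p, variance I.featureCoords w (I.featureCoords p) := rfl

theorem featureCoords_dotProduct (p : Fin K × Fin K) (u : EuclideanSpace ℝ (Fin d)) :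
    I.featureCoords p ⬝ᵥ u.ofLp = inner ℝ (I.feature p.1 p.2) u := by
  rw [EuclideanSpace.inner_eq_star_dotProduct, star_trivial, dotProduct_comm]
  rfl

variable {I}

theorem FeatureRegularity.mul_norm_sq_le {lam : ℝ} (h : I.FeatureRegularity lam)
    (u : EuclideanSpace ℝ (Fin d)) :
    lam * ‖u‖ ^ 2 ≤ ∑ p : Fin K × Fin K, 1 / (K : ℝ) ^ 2 * inner ℝ (I.feature p.1 p.2) u ^ 2 := by
  have := h.dotProduct_mulVec_nonneg u.ofLp
  rw [star_trivial, sub_mulVec, dotProduct_sub, smul_mulVec, one_mulVec, dotProduct_smul,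
    designMatrix_eq_moment, dotProduct_moment_mulVec, sub_nonneg] at this
  simp only [featureCoords_dotProduct] at this
  refine le_trans (le_of_eq ?_) this
  rw [EuclideanSpace.real_norm_sq_eq, smul_eq_mul, dotProduct]
  simp only [sq]

theorem uniform_mem_stdSimplex (K : ℕ) [NeZero K] :
    (fun _ => 1 / (K : ℝ) ^ 2) ∈ stdSimplex ℝ (Fin K × Fin K) := by
  have : (K : ℝ) ≠ 0 := NeZero.ne _
  refine ⟨fun _ => by positivity, ?_⟩
  simp
  field_simp

/-- A lower bound of all averages by `lam`. -/
theorem FeatureRegularity.mul_norm_sq_le_of_forall [NeZero K] {lam b : ℝ}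
    (h : I.FeatureRegularity lam) {u : EuclideanSpace ℝ (Fin d)}
    (hb : ∀ p : Fin K × Fin K, inner ℝ (I.feature p.1 p.2) u ^ 2 ≤ b) : lam * ‖u‖ ^ 2 ≤ b := by
  refine (h.mul_norm_sq_le u).trans ?_
  have hs := uniform_mem_stdSimplex K
  calc _ ≤ ∑ p : Fin K × Fin K, 1 / (K : ℝ) ^ 2 * b :=
        Finset.sum_le_sum fun p _ => mul_le_mul_of_nonneg_left (hb p) (hs.1 p)
    _ = b := by rw [← Finset.sum_mul, hs.2, one_mul]

theorem FeatureRegularity.posDef {lam : ℝ} (h : I.FeatureRegularity lam) (hlam : 0 < lam) :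
    (I.designMatrix fun _ => 1 / (K : ℝ) ^ 2).PosDef := by
  have := PosDef.posSemidef_add h ((PosDef.one (n := Fin d) (R := ℝ)).smul hlam)
  simpa using this

-- The maximum of the variance is at least its `w`-average, which is `d`.
variable (I) in
theorem IsDesign.le_designValue [NeZero K] {w : Fin K × Fin K → ℝ} (hw : I.IsDesign w) :
    (d : ℝ) ≤ I.designValue w := by
  rw [← sum_mul_variance I.featureCoords hw.2.2, designValue_eq]
  calc _ ≤ ∑ p, w p * ⨆ p, variance I.featureCoords w (I.featureCoords p) :=
        Finset.sum_le_sum fun p _ => mul_le_mul_of_nonneg_left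
          (le_ciSup (Set.finite_range fun p => variance I.featureCoords w (I.featureCoords p)).bddAbove
            p) (hw.1 p)
    _ = _ := by rw [← Finset.sum_mul, hw.2.1, one_mul]

/-- The Kiefer–Wolfowitz theorem with a support bound. -/
theorem FeatureRegularity.exists_design [NeZero K] {lam : ℝ} (h : I.FeatureRegularity lam)
    (hlam : 0 < lam) (hd : 1 ≤ d) :
    ∃ w, I.IsDesign w ∧ I.designValue w ≤ d ∧
      (Function.support w).ncard ≤ d * (d + 1) / 2 := by
  obtain ⟨w, hw, hV, hle, hc⟩ := exists_variance_le_ncard_support_le (by omega)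
    (uniform_mem_stdSimplex K) (h.posDef hlam)
  exact ⟨w, ⟨hw.1, hw.2, hV⟩, ciSup_le hle, hc⟩

theorem FeatureRegularity.exists_isGOptimal [NeZero K] {lam : ℝ} (h : I.FeatureRegularity lam)
    (hlam : 0 < lam) (hd : 1 ≤ d) :
    ∃ w, I.IsGOptimal w ∧ (Function.support w).ncard ≤ d * (d + 1) / 2 := by
  obtain ⟨w, hw, hle, hc⟩ := h.exists_design hlam hd
  exact ⟨w, ⟨hw, fun w' hw' => hle.trans (IsDesign.le_designValue I hw')⟩, hc⟩

/-- Comparison with the design of `exists_design` bounds the variance of any G-optimal design by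
`d`; then apply the Cauchy–Schwarz inequality for `V` and `V⁻¹`. -/
theorem IsGOptimal.inner_sq_le [NeZero K] {lam : ℝ} (h : I.FeatureRegularity lam)
    (hlam : 0 < lam) (hd : 1 ≤ d) {w : Fin K × Fin K → ℝ} (hw : I.IsGOptimal w)
    (p : Fin K × Fin K) (u : EuclideanSpace ℝ (Fin d)) :
    inner ℝ (I.feature p.1 p.2) u ^ 2 ≤
      d * ∑ q : Fin K × Fin K, w q * inner ℝ (I.feature q.1 q.2) u ^ 2 := by
  obtain ⟨w', hw', hle, -⟩ := h.exists_design hlam hd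
  have h1 : variance I.featureCoords w (I.featureCoords p) ≤ d :=
    (le_ciSup (Set.finite_range fun p =>
      variance I.featureCoords w (I.featureCoords p)).bddAbove p).trans ((hw.2 w' hw').trans hle)
  have h2 := sq_dotProduct_le hw.1.2.2 (I.featureCoords p) u.ofLp
  rw [designMatrix_eq_moment, dotProduct_moment_mulVec] at h2
  simp only [featureCoords_dotProduct] at h2
  exact h2.trans (mul_le_mul_of_nonneg_right h1
    (Finset.sum_nonneg fun q _ => mul_nonneg (hw.1.1 q) (sq_nonneg _)))

/-! ### The commit step -/

variable (I) in
/-- The weighted sum of the noise `∑ (r_t - p_t) φ_t`. -/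
def noise {n : ℕ} (h : DuelHistory K n) : EuclideanSpace ℝ (Fin d) :=
  ∑ t, ((if (h t).2 then (1 : ℝ) else 0) - I.pref (h t).1.1 (h t).1.2) •
    I.feature (h t).1.1 (h t).1.2

variable (I) in
/-- The quadratic form `∑ ⟪φ_t, u⟫²` of a sequence of queries. -/
def gram {n : ℕ} (a : Fin n → Fin K × Fin K) (u : EuclideanSpace ℝ (Fin d)) : ℝ :=
  ∑ t, inner ℝ (I.feature (a t).1 (a t).2) u ^ 2

theorem deriv_link_nonneg (x : ℝ) : 0 ≤ deriv I.link x := I.link_mono.deriv_nonneg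

theorem slopeBound : SlopeBound I.link I.param I.kappa := fun x θ hx hθ =>
  csInf_le ⟨0, by rintro y ⟨x, θ, -, -, rfl⟩; exact deriv_link_nonneg _⟩ ⟨x, θ, hx, hθ, rfl⟩

theorem kappa_le {L M : ℝ} (h : I.LinkSmooth L M) : I.kappa ≤ L :=
  (slopeBound 0 I.param (by simp) (by simp)).trans (h.2.2.1 _)

theorem abs_link_sub_le {L M : ℝ} (h : I.LinkSmooth L M) (a b : ℝ) :
    |I.link a - I.link b| ≤ L * |a - b| := by
  have := Convex.norm_image_sub_le_of_norm_deriv_le (f := I.link) (s := Set.univ) (C := L)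
    (x := b) (y := a) (fun x _ => h.1 x) (fun x _ => by
      rw [Real.norm_eq_abs, abs_of_nonneg (deriv_link_nonneg x)]; exact h.2.2.1 x)
    convex_univ trivial trivial
  simpa using this

theorem abs_bordaAt_sub_borda_le [NeZero K] {L M b : ℝ} (hL : 0 ≤ L) (h : I.LinkSmooth L M)
    {θ : EuclideanSpace ℝ (Fin d)} (hb : ∀ i j, |inner ℝ (I.feature i j) (θ - I.param)| ≤ b)
    (i : Fin K) : |I.bordaAt θ i - I.borda i| ≤ L * b := by
  have hK : (0 : ℝ) < K := Nat.cast_pos.2 (NeZero.pos K)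
  unfold bordaAt borda pref
  rw [← mul_sub, ← Finset.sum_sub_distrib, abs_mul, abs_of_pos (by positivity)]
  have h1 : |∑ j, (I.link (inner ℝ (I.feature i j) θ) - I.link (inner ℝ (I.feature i j) I.param))|
      ≤ ∑ _j : Fin K, L * b := by
    refine (Finset.abs_sum_le_sum_abs _ _).trans (Finset.sum_le_sum fun j _ => ?_)
    refine (abs_link_sub_le h _ _).trans (mul_le_mul_of_nonneg_left ?_ hL)
    rw [← inner_sub_right]
    exact hb i j
  rw [Finset.sum_const, Finset.card_univ, Fintype.card_fin, nsmul_eq_mul] at h1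
  rw [one_div, inv_mul_le_iff₀ hK]
  exact h1

/-- The regret of the committed item on data with small noise. -/
theorem CommitRule.two_mul_iSup_borda_sub_le [NeZero K] {L M lam ε β : ℝ} {n : ℕ}
    (hsm : I.LinkSmooth L M) (hκ : 0 < I.kappa) (hreg : I.FeatureRegularity lam)
    (hε : 0 < ε) (hβ : 0 ≤ β) (rule : I.CommitRule n) {h : DuelHistory K n}
    (hgram : ∀ (p : Fin K × Fin K) u,
      inner ℝ (I.feature p.1 p.2) u ^ 2 ≤ ε ^ 2 * I.gram (fun t => (h t).1) u)
    (hnoise : ∀ u, inner ℝ (I.noise h) u ^ 2 ≤ β ^ 2 * I.gram (fun t => (h t).1) u)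
    (hsmall : β ^ 2 * ε ^ 2 < I.kappa ^ 2 * lam) :
    2 * (⨆ i, I.borda i) - I.borda (rule.arm h) - I.borda (rule.arm h) ≤
      4 * (L * (ε * β / I.kappa)) := by
  have hL : 0 ≤ L := hκ.le.trans (kappa_le hsm)
  -- Averaging `hgram` over all pairs turns feature regularity into `lam ≤ ε² Q(u)` for unit `u`.
  have hQ : ∀ u : EuclideanSpace ℝ (Fin d), ‖u‖ = 1 →
      β ^ 2 < I.kappa ^ 2 * ∑ t, inner ℝ (I.feature (h t).1.1 (h t).1.2) u ^ 2 := fun u hu => by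
    have h1 := hreg.mul_norm_sq_le_of_forall fun p => hgram p u
    rw [hu, one_pow, mul_one] at h1
    have h2 := mul_le_mul_of_nonneg_left h1 (sq_nonneg I.kappa)
    have h3 : β ^ 2 * ε ^ 2 <
        (I.kappa ^ 2 * ∑ t, inner ℝ (I.feature (h t).1.1 (h t).1.2) u ^ 2) * ε ^ 2 := by
      refine hsmall.trans_le (h2.trans (le_of_eq ?_)); unfold gram; ring
    exact lt_of_mul_lt_mul_right h3 (sq_nonneg _)
  have hmle : ∀ θ, I.IsMLE h θ ↔ ∑ t, ((if (h t).2 then (1 : ℝ) else 0) -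
      I.link (inner ℝ (I.feature (h t).1.1 (h t).1.2) θ)) • I.feature (h t).1.1 (h t).1.2 = 0 :=
    fun θ => by
      simp only [sub_smul, Finset.sum_sub_distrib, sub_eq_zero]
      exact eq_comm
  have hex : ∃ θ, I.IsMLE h θ := by
    simp only [hmle]
    exact exists_likelihood_solution I.link_mono hsm.1 slopeBound hκ
      (fun t => I.norm_feature_le _ _) hnoise hQ
  have hest := (hmle _).1 (rule.est_spec h hex)
  have hclose := (likelihood_solution_close (r := fun t => if (h t).2 then (1 : ℝ) else 0)
    (x := fun t => I.feature (h t).1.1 (h t).1.2) I.link_mono hsm.1 slopeBound hκ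
    (fun t => I.norm_feature_le _ _) hnoise hQ (by rw [hest, inner_zero_left])).2
  have hpred : ∀ i j, |inner ℝ (I.feature i j) (rule.est h - I.param)| ≤ ε * β / I.kappa :=
    fun i j => by
      refine abs_le_of_sq_le_sq ?_ (by positivity)
      rw [div_pow, le_div_iff₀ (by positivity)]
      have h1 := mul_le_mul_of_nonneg_right (hgram (i, j) (rule.est h - I.param))
        (sq_nonneg I.kappa)
      have h2 := mul_le_mul_of_nonneg_left hclose (sq_nonneg ε)
      refine h1.trans (le_trans (le_of_eq ?_) (h2.trans (le_of_eq ?_)))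
      · unfold gram; ring
      · ring
  have hB := fun i => abs_le.1 (abs_bordaAt_sub_borda_le hL hsm hpred i)
  -- The estimated scores are off by at most `L ε β / κ` at the best item and at the chosen one;
  -- playing the chosen item twice doubles this to the factor 4.
  have hsup : (⨆ i, I.borda i) ≤ I.borda (rule.arm h) + 2 * (L * (ε * β / I.kappa)) :=
    ciSup_le fun i => by
      have h1 := (hB i).1
      have h2 := (hB (rule.arm h)).2
      have h3 := rule.arm_spec h i
      linarith
  linarith

end GLMDuelingBandit
end

noncomputable section

/-! ### Tails of sums of squares of sub-Gaussian variables. -/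

section SubgaussianSums

open MeasureTheory ProbabilityTheory

/-- A sub-Gaussian variable with variance proxy `1 / 4` has `E exp (Y ^ 2) ≤ 2`. -/
theorem sum_mul_exp_sq_le_two {α : Type*} [Fintype α] {w Y : α → ℝ}
    (h : ∀ s : ℝ, ∑ r, w r * Real.exp (s * Y r) ≤ Real.exp (s ^ 2 / 8)) :
    ∑ r, w r * Real.exp (Y r ^ 2) ≤ 2 := by
  -- Linearize the square with a standard Gaussian `g`: `exp (Y²) = E exp (√2 Y g)`. Exchanging the
  -- averages, the hypothesis at `s = √2 g` leaves `E exp (g²/4) = √2`.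
  have hpdf : ∀ x : ℝ, gaussianPDFReal 0 1 x * Real.exp (x ^ 2 / 4) =
      (√(2 * Real.pi))⁻¹ * Real.exp (-(1 / 4) * x ^ 2) := fun x => by
    rw [gaussianPDFReal, mul_assoc, ← Real.exp_add]
    congr 2
    · simp
    · simp; ring
  have hint : Integrable (fun x : ℝ => Real.exp (x ^ 2 / 4)) (gaussianReal 0 1) := by
    rw [gaussianReal_of_var_ne_zero 0 one_ne_zero]
    rw [integrable_withDensity_iff_integrable_smul' (measurable_gaussianPDF 0 1)
      (by simp [gaussianPDF])]
    simp only [toReal_gaussianPDF, smul_eq_mul, hpdf]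
    exact (integrable_exp_neg_mul_sq (by norm_num)).const_mul _
  have hval : ∫ x : ℝ, Real.exp (x ^ 2 / 4) ∂gaussianReal 0 1 ≤ 2 := by
    rw [integral_gaussianReal_eq_integral_smul one_ne_zero]
    simp only [smul_eq_mul, hpdf]
    rw [integral_const_mul, integral_gaussian, ← Real.sqrt_inv, ← Real.sqrt_mul (by positivity)]
    rw [Real.sqrt_le_left (by norm_num)]
    have := Real.pi_pos
    field_simp
    norm_num
  have hmgf : ∀ r, Integrable (fun x : ℝ => w r * Real.exp (√2 * Y r * x)) (gaussianReal 0 1) :=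
    fun r => (integrable_exp_mul_gaussianReal (√2 * Y r)).const_mul _
  have heq : ∀ r, ∫ x : ℝ, w r * Real.exp (√2 * Y r * x) ∂gaussianReal 0 1 =
      w r * Real.exp (Y r ^ 2) := fun r => by
    rw [integral_const_mul]
    congr 1
    have := congrFun (mgf_id_gaussianReal (μ := 0) (v := 1)) (√2 * Y r)
    simp only [mgf, id] at this
    rw [this, mul_pow, Real.sq_sqrt (by norm_num)]
    congr 1
    simp
  calc ∑ r, w r * Real.exp (Y r ^ 2)
      = ∫ x : ℝ, ∑ r, w r * Real.exp (√2 * Y r * x) ∂gaussianReal 0 1 := by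
        rw [integral_finsetSum _ fun r _ => hmgf r]
        exact Finset.sum_congr rfl fun r _ => (heq r).symm
    _ ≤ ∫ x : ℝ, Real.exp (x ^ 2 / 4) ∂gaussianReal 0 1 := by
        refine integral_mono (integrable_finsetSum _ fun r _ => hmgf r) hint fun x => ?_
        have := h (√2 * x)
        rw [mul_pow, Real.sq_sqrt (by norm_num)] at this
        refine le_trans (le_of_eq ?_) (this.trans (le_of_eq ?_))
        · exact Finset.sum_congr rfl fun r _ => by ring_nf
        · ring_nf
    _ ≤ 2 := hval

/-- The tail of a sum of squares of sub-Gaussian variables. -/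
theorem sum_indicator_le {α : Type*} [Fintype α] {d : ℕ} (hd : 1 ≤ d) {δ : ℝ} (hδ : 0 < δ)
    {w : α → ℝ} {Y : α → Fin d → ℝ} (hw : ∀ r, 0 ≤ w r)
    (h : ∀ i, ∑ r, w r * Real.exp (Y r i ^ 2) ≤ 2) :
    ∑ r, {r | d * Real.log (2 / δ) < ∑ i, Y r i ^ 2}.indicator w r ≤ δ := by
  have hd0 : (0 : ℝ) < d := by exact_mod_cast hd
  -- The event forces the mean of the `Y_i²` above `log (2/δ)`. Jensen's inequality for `exp`
  -- followed by Markov's inequality needs no independence between coordinates.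
  have hpt : ∀ r, {r | d * Real.log (2 / δ) < ∑ i, Y r i ^ 2}.indicator w r ≤
      w r * (δ / 2 * ∑ i, (d : ℝ)⁻¹ * Real.exp (Y r i ^ 2)) := fun r => by
    refine Set.indicator_apply_le' (fun hr => le_mul_of_one_le_right (hw r) ?_) fun hr => ?_
    · have h2 : 2 / δ ≤ Real.exp (∑ i, (d : ℝ)⁻¹ * Y r i ^ 2) := by
        rw [← Real.log_le_iff_le_exp (by positivity), ← Finset.mul_sum, le_inv_mul_iff₀ hd0]
        exact le_of_lt hr
      have h3 := convexOn_exp.map_sum_le (t := Finset.univ) (w := fun _ : Fin d => (d : ℝ)⁻¹)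
        (p := fun i => Y r i ^ 2)
        (fun _ _ => by positivity) (by simp; field_simp) (fun _ _ => trivial)
      simp only [smul_eq_mul] at h3
      have h4 := mul_le_mul_of_nonneg_left (h2.trans h3) (by positivity : 0 ≤ δ / 2)
      refine le_trans (le_of_eq ?_) h4
      field_simp
    · have := hw r
      positivity
  calc _ ≤ ∑ r, w r * (δ / 2 * ∑ i, (d : ℝ)⁻¹ * Real.exp (Y r i ^ 2)) :=
        Finset.sum_le_sum fun r _ => hpt r
    _ = δ / 2 * ((d : ℝ)⁻¹ * ∑ i, ∑ r, w r * Real.exp (Y r i ^ 2)) := by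
        rw [Finset.sum_comm, Finset.mul_sum, Finset.mul_sum]
        refine Finset.sum_congr rfl fun r _ => ?_
        rw [← Finset.mul_sum, ← Finset.mul_sum]
        ring
    _ ≤ δ / 2 * ((d : ℝ)⁻¹ * ∑ _i : Fin d, 2) := by
        gcongr with i
        exact h i
    _ = δ := by simp; field_simp

end SubgaussianSums

/-! ### Diagonalization of the Gram form. -/

section EigenFrame

variable {d : ℕ} {ι : Type*} [Fintype ι]

/-- A frame that diagonalizes the form `∑ ⟪x_t, u⟫²` and its dual. -/
theorem exists_dual_frame (x : ι → EuclideanSpace ℝ (Fin d))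
    (hx : ∀ u : EuclideanSpace ℝ (Fin d), u ≠ 0 → 0 < ∑ t, inner ℝ (x t) u ^ 2) :
    ∃ b : Fin d → EuclideanSpace ℝ (Fin d), (∀ i, ∑ t, inner ℝ (x t) (b i) ^ 2 = 1) ∧
      ∀ z u : EuclideanSpace ℝ (Fin d),
        inner ℝ z u ^ 2 ≤ (∑ i, inner ℝ z (b i) ^ 2) * ∑ t, inner ℝ (x t) u ^ 2 := by
  let A : EuclideanSpace ℝ (Fin d) →ₗ[ℝ] EuclideanSpace ℝ (Fin d) :=
    ∑ t, ((innerSL ℝ (x t)).toLinearMap).smulRight (x t)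
  have hA : ∀ u, A u = ∑ t, inner ℝ (x t) u • x t := fun u => by simp [A]
  have hAi : ∀ u v, inner ℝ (A u) v = ∑ t, inner ℝ (x t) u * inner ℝ (x t) v := fun u v => by
    simp [hA, sum_inner, inner_smul_left]
  have hsymm : A.IsSymmetric := fun u v => by
    have h1 : inner ℝ u (A v) = inner ℝ (A v) u := real_inner_comm _ _
    rw [h1, hAi, hAi]
    exact Finset.sum_congr rfl fun t _ => mul_comm _ _
  have hfr : Module.finrank ℝ (EuclideanSpace ℝ (Fin d)) = d := finrank_euclideanSpace_fin
  let e := hsymm.eigenvectorBasis hfr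
  let l := hsymm.eigenvalues hfr
  have hAe : ∀ i, A (e i) = l i • e i := fun i => hsymm.apply_eigenvectorBasis hfr i
  have hQ : ∀ i, ∑ t, inner ℝ (x t) (e i) ^ 2 = l i := fun i => by
    have h1 : inner ℝ (A (e i)) (e i) = l i := by
      rw [hAe, inner_smul_left, real_inner_self_eq_norm_sq, e.norm_eq_one]; simp
    rw [← h1, hAi]
    exact Finset.sum_congr rfl fun t _ => sq _
  have hl : ∀ i, 0 < l i := fun i => by
    rw [← hQ]; exact hx _ (e.orthonormal.ne_zero i)
  -- Rescaled eigenvectors of the Gram operator; the dual bound is the Cauchy–Schwarz inequality in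
  -- eigencoordinates.
  refine ⟨fun i => (√(l i))⁻¹ • e i, fun i => ?_, fun z u => ?_⟩
  · simp only [inner_smul_right, mul_pow, ← Finset.mul_sum, hQ]
    rw [inv_pow, Real.sq_sqrt (hl i).le, inv_mul_cancel₀ (hl i).ne']
  · have hu : ∑ t, inner ℝ (x t) u ^ 2 = ∑ i, (√(l i) * inner ℝ (e i) u) ^ 2 := by
      have h1 : ∑ t, inner ℝ (x t) u ^ 2 = inner ℝ (A u) u := by
        rw [hAi]; exact Finset.sum_congr rfl fun t _ => sq _
      rw [h1, ← e.sum_inner_mul_inner]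
      refine Finset.sum_congr rfl fun i _ => ?_
      rw [hsymm u (e i), hAe, inner_smul_right, mul_pow, Real.sq_sqrt (hl i).le,
        real_inner_comm u (e i)]
      ring
    rw [hu, ← e.sum_inner_mul_inner]
    refine le_trans (le_of_eq ?_) (Finset.sum_mul_sq_le_sq_mul_sq _ _ _)
    congr 1
    refine Finset.sum_congr rfl fun i _ => ?_
    rw [inner_smul_right]
    have := Real.sqrt_ne_zero'.2 (hl i)
    field_simp

end EigenFrame

/-! ### Concentration of the noise for fixed queries. -/

namespace GLMDuelingBandit

open MeasureTheory ProbabilityTheory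

variable {K d : ℕ} (I : GLMDuelingBandit K d)

theorem pref_nonneg (i j : Fin K) : 0 ≤ I.pref i j := (I.link_mem i j).1

theorem pref_le_one (i j : Fin K) : I.pref i j ≤ 1 := (I.link_mem i j).2

theorem feedback_toReal (p : Fin K × Fin K) (b : Bool) :
    (I.feedback p b).toReal = if b then I.pref p.1 p.2 else 1 - I.pref p.1 p.2 := by
  have h0 := I.pref_nonneg p.1 p.2
  have h1 := I.pref_le_one p.1 p.2
  rw [feedback, PMF.ofFintype_apply, ENNReal.toReal_ofReal]
  split_ifs <;> linarith

/-- Hoeffding's lemma for the feedback of one query. -/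
theorem sum_feedback_mul_exp_le (p : Fin K × Fin K) (s : ℝ) :
    ∑ b, (I.feedback p b).toReal *
      Real.exp (s * ((if b then (1 : ℝ) else 0) - I.pref p.1 p.2)) ≤ Real.exp (s ^ 2 / 8) := by
  have h := hasSubgaussianMGF_of_mem_Icc (μ := (I.feedback p).toMeasure) (a := 0) (b := 1)
    (X := fun b : Bool => if b then (1 : ℝ) else 0) (Measurable.of_discrete).aemeasurable
    (Filter.Eventually.of_forall fun b => by cases b <;> simp)
  have hm : ∫ b, (if b then (1 : ℝ) else 0) ∂(I.feedback p).toMeasure = I.pref p.1 p.2 := by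
    rw [PMF.integral_eq_sum]
    simp [feedback_toReal]
  have h2 := h.mgf_le s
  rw [hm, mgf, PMF.integral_eq_sum] at h2
  simp only [smul_eq_mul] at h2
  refine h2.trans (le_of_eq ?_)
  congr 1
  simp
  ring

/-- The probability of a feedback sequence for a fixed sequence of queries. -/
def feedbackWeight {n : ℕ} (a : Fin n → Fin K × Fin K) (r : Fin n → Bool) : ℝ :=
  ∏ t, (I.feedback (a t) (r t)).toReal

theorem feedbackWeight_nonneg {n : ℕ} (a : Fin n → Fin K × Fin K) (r : Fin n → Bool) :
    0 ≤ I.feedbackWeight a r := Finset.prod_nonneg fun _ _ => ENNReal.toReal_nonneg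

/-- The exponential moment factors over rounds; the variance proxies from Hoeffding's lemma add up
to `I.gram a b / 4 = 1 / 4`. -/
theorem sum_feedbackWeight_mul_exp_le {n : ℕ} (a : Fin n → Fin K × Fin K)
    {b : EuclideanSpace ℝ (Fin d)} (hb : I.gram a b = 1) (s : ℝ) :
    ∑ r, I.feedbackWeight a r * Real.exp (s * inner ℝ (I.noise fun t => (a t, r t)) b) ≤
      Real.exp (s ^ 2 / 8) := by
  have h1 : ∀ r : Fin n → Bool,
      I.feedbackWeight a r * Real.exp (s * inner ℝ (I.noise fun t => (a t, r t)) b) =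
      ∏ t, (I.feedback (a t) (r t)).toReal * Real.exp (s * inner ℝ (I.feature (a t).1 (a t).2) b *
        ((if r t then (1 : ℝ) else 0) - I.pref (a t).1 (a t).2)) := fun r => by
    rw [Finset.prod_mul_distrib, ← Real.exp_sum]
    unfold feedbackWeight noise
    congr 2
    rw [sum_inner, Finset.mul_sum]
    refine Finset.sum_congr rfl fun t _ => ?_
    rw [inner_smul_left, conj_trivial]
    ring
  simp only [h1]
  rw [← Fintype.piFinset_univ, ← Finset.prod_univ_sum (fun _ => Finset.univ) fun t c =>
    (I.feedback (a t) c).toReal * Real.exp (s * inner ℝ (I.feature (a t).1 (a t).2) b *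
        ((if c then (1 : ℝ) else 0) - I.pref (a t).1 (a t).2))]
  calc _ ≤ ∏ t, Real.exp ((s * inner ℝ (I.feature (a t).1 (a t).2) b) ^ 2 / 8) :=
        Finset.prod_le_prod (fun t _ => Finset.sum_nonneg fun c _ => by positivity)
          fun t _ => I.sum_feedback_mul_exp_le (a t) _
    _ = Real.exp (s ^ 2 / 8) := by
        rw [← Real.exp_sum]
        congr 1
        simp only [mul_pow, mul_div_right_comm _ _ (8 : ℝ), ← Finset.mul_sum]
        change s ^ 2 / 8 * I.gram a b = _
        rw [hb, mul_one]

/-- The tail of the noise in the norm dual to the Gram form, for fixed queries. -/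
theorem sum_feedbackWeight_noise_le {n : ℕ} (hd : 1 ≤ d) (a : Fin n → Fin K × Fin K)
    (ha : ∀ u, u ≠ 0 → 0 < I.gram a u) {δ : ℝ} (hδ : 0 < δ) :
    ∑ r, {r | ¬ ∀ u, inner ℝ (I.noise fun t => (a t, r t)) u ^ 2 ≤
      d * Real.log (2 / δ) * I.gram a u}.indicator (I.feedbackWeight a) r ≤ δ := by
  -- The frame depends only on the queries, so its `d` directions are fixed before the feedback is
  -- drawn and no net is needed.
  obtain ⟨b, hb, hdual⟩ := exists_dual_frame (fun t => I.feature (a t).1 (a t).2) ha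
  have h := sum_indicator_le (α := Fin n → Bool) (w := I.feedbackWeight a)
    (Y := fun r i => inner ℝ (I.noise fun t => (a t, r t)) (b i)) hd hδ
    (I.feedbackWeight_nonneg a) fun i =>
      sum_mul_exp_sq_le_two fun s => I.sum_feedbackWeight_mul_exp_le a (hb i) s
  refine le_trans (Finset.sum_le_sum fun r _ => ?_) h
  refine Set.indicator_le_indicator_of_subset (fun r hr => ?_) (I.feedbackWeight_nonneg a) r
  by_contra hle
  exact hr fun u => (hdual _ u).trans
    (mul_le_mul_of_nonneg_right (not_lt.1 hle) (Finset.sum_nonneg fun t _ => sq_nonneg _))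

end GLMDuelingBandit
end

noncomputable section

/-! ### The law of the history and its marginals. -/

theorem PMF.sum_bind_mul {α β : Type*} [Fintype α] [Fintype β] (p : PMF α) (q : α → PMF β)
    (f : β → ENNReal) : ∑ b, p.bind q b * f b = ∑ a, p a * ∑ b, q a b * f b := by
  simp only [PMF.bind_apply, tsum_fintype, Finset.sum_mul, Finset.mul_sum, mul_assoc]
  exact Finset.sum_comm

theorem PMF.sum_map_mul {α β : Type*} [Fintype α] [Fintype β] (p : PMF α) (g : α → β)
    (f : β → ENNReal) : ∑ b, p.map g b * f b = ∑ a, p a * f (g a) := by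
  classical
  rw [PMF.map, PMF.sum_bind_mul]
  simp [PMF.pure_apply]

theorem PMF.sum_coe {α : Type*} [Fintype α] (p : PMF α) : ∑ a, p a = 1 := by
  rw [← tsum_fintype (L := .unconditional _), p.tsum_coe]

namespace GLMDuelingBandit

open MeasureTheory

variable {K d : ℕ} (I : GLMDuelingBandit K d)

section HistoryLaw

variable (policy : (t : ℕ) → DuelHistory K t → PMF (Fin K × Fin K))

theorem sum_historyLaw_succ_mul (n : ℕ) (f : DuelHistory K (n + 1) → ENNReal) :
    ∑ h, I.historyLaw policy (n + 1) h * f h =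
      ∑ h, I.historyLaw policy n h * ∑ p, policy n h p * ∑ b, I.feedback p b *
        f (Fin.snoc (α := fun _ => (Fin K × Fin K) × Bool) h (p, b)) := by
  simp only [historyLaw, PMF.sum_bind_mul, PMF.sum_map_mul]

theorem snoc_prodMk {n : ℕ} (a : Fin n → Fin K × Fin K) (r : Fin n → Bool) (p : Fin K × Fin K)
    (b : Bool) :
    (Fin.snoc (α := fun _ => (Fin K × Fin K) × Bool) (fun t => (a t, r t)) (p, b) :
      DuelHistory K (n + 1)) =
    fun t => (Fin.snoc (α := fun _ => Fin K × Fin K) a p t,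
      Fin.snoc (α := fun _ => Bool) r b t) := by
  ext1 t
  refine Fin.lastCases ?_ (fun t => ?_) t <;> simp

variable {policy} in
/-- If the queries do not depend on the history, a bound for all fixed sequences of queries is a
bound under the law of the history. -/
theorem sum_historyLaw_mul_le {n : ℕ} (hpol : ∀ t < n, ∀ h h', policy t h = policy t h')
    {f : DuelHistory K n → ENNReal} {B : ENNReal}
    (hf : ∀ a : Fin n → Fin K × Fin K,
      ∑ r : Fin n → Bool, (∏ t, I.feedback (a t) (r t)) * f (fun t => (a t, r t)) ≤ B) :
    ∑ h, I.historyLaw policy n h * f h ≤ B := by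
  classical
  induction n with
  | zero =>
    refine le_trans (le_of_eq ?_) (hf Fin.elim0)
    rw [Fintype.sum_subsingleton _ (Fin.elim0 : DuelHistory K 0),
      Fintype.sum_subsingleton _ (Fin.elim0 : Fin 0 → Bool)]
    rw [historyLaw, PMF.pure_apply, if_pos rfl, Finset.univ_eq_empty, Finset.prod_empty]
    congr 2
    exact Subsingleton.elim _ _
  | succ n ih =>
    rw [sum_historyLaw_succ_mul]
    -- There may be no histories at all, when `K = 0` and `n > 0`.
    rcases isEmpty_or_nonempty (DuelHistory K n) with hE | ⟨⟨h₀⟩⟩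
    · simp
    have hq : ∀ h, policy n h = policy n h₀ := fun h => hpol n n.lt_succ_self h h₀
    simp only [hq]
    refine ih (fun t ht => hpol t (ht.trans n.lt_succ_self)) fun a => ?_
    -- Since the law of the new query is the same for all histories, it can be averaged outside the
    -- feedback sum.
    calc ∑ r : Fin n → Bool, (∏ t, I.feedback (a t) (r t)) * ∑ p, policy n h₀ p *
          ∑ b, I.feedback p b * f (Fin.snoc (α := fun _ => (Fin K × Fin K) × Bool)
            (fun t => (a t, r t)) (p, b))
        = ∑ p, policy n h₀ p * ∑ r : Fin n → Bool, ∑ b,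
            (∏ t, I.feedback (a t) (r t)) * I.feedback p b *
            f (Fin.snoc (α := fun _ => (Fin K × Fin K) × Bool) (fun t => (a t, r t)) (p, b)) := by
          simp only [Finset.mul_sum]
          rw [Finset.sum_comm]
          refine Finset.sum_congr rfl fun p _ => Finset.sum_congr rfl fun r _ =>
            Finset.sum_congr rfl fun b _ => ?_
          ring
      _ ≤ ∑ p, policy n h₀ p * B := by
          gcongr with p
          refine le_trans (le_of_eq ?_)
            (hf (Fin.snoc (α := fun _ => Fin K × Fin K) a p))
          rw [← (Fin.snocEquiv fun _ => Bool).sum_comp, Fintype.sum_prod_type, Finset.sum_comm]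
          refine Finset.sum_congr rfl fun b _ => Finset.sum_congr rfl fun r _ => ?_
          rw [snoc_prodMk, Fin.prod_univ_castSucc]
          simp [Fin.snocEquiv]
      _ = B := by rw [← Finset.sum_mul, PMF.sum_coe, one_mul]

/-- The first `n` rounds of a history. -/
def _root_.DuelHistory.take {K n T : ℕ} (hn : n ≤ T) (h : DuelHistory K T) : DuelHistory K n :=
  fun s => h (Fin.castLE hn s)

/-- Events of the exploration phase can be measured under the law stopped before the commit. -/
theorem historyLaw_map_take {n T : ℕ} (hn : n ≤ T) :
    (I.historyLaw policy T).map (DuelHistory.take hn) = I.historyLaw policy n := by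
  induction T, hn using Nat.le_induction with
  | base => exact PMF.map_id _
  | succ T hn ih =>
    rw [historyLaw, PMF.map_bind]
    simp only [PMF.map_bind, PMF.map_comp]
    have h1 : ∀ (h : DuelHistory K T) (p : Fin K × Fin K),
        DuelHistory.take (hn.trans T.le_succ) ∘
          (fun r => Fin.snoc (α := fun _ => (Fin K × Fin K) × Bool) h (p, r)) =
        Function.const Bool (DuelHistory.take hn h) := fun h p => by
      ext1 r
      ext1 s
      exact Fin.snoc_castSucc (α := fun _ => (Fin K × Fin K) × Bool) (p, r) h (Fin.castLE hn s)
    simp only [h1, PMF.map_const, PMF.bind_const]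
    exact ih

/-- For the deterministic phases this pins down the queries on every history of positive
probability. -/
theorem mem_support_policy {T : ℕ} {h : DuelHistory K T}
    (hh : h ∈ (I.historyLaw policy T).support) (t : Fin T) :
    (h t).1 ∈ (policy t (h.take t.2.le)).support := by
  induction T with
  | zero => exact t.elim0
  | succ T ih =>
    rw [historyLaw, PMF.mem_support_bind_iff] at hh
    obtain ⟨h', hh', hh⟩ := hh
    rw [PMF.mem_support_bind_iff] at hh
    obtain ⟨p, hp, hh⟩ := hh
    rw [PMF.mem_support_map_iff] at hh
    obtain ⟨r, -, rfl⟩ := hh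
    have htake : ∀ {m : ℕ} (hm : m ≤ T),
        DuelHistory.take (hm.trans T.le_succ)
          (Fin.snoc (α := fun _ => (Fin K × Fin K) × Bool) h' (p, r)) = h'.take hm := fun hm => by
      ext1 s
      exact Fin.snoc_castSucc (α := fun _ => (Fin K × Fin K) × Bool) (p, r) h' (Fin.castLE hm s)
    refine Fin.lastCases ?_ (fun t => ?_) t
    · have := htake le_rfl
      simp only [Fin.val_last, Fin.snoc_last]
      rw [this]
      exact hp
    · have := htake t.2.le
      simp only [Fin.val_castSucc, Fin.snoc_castSucc]
      rw [this]
      exact ih hh' t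

end HistoryLaw

theorem prod_feedback_eq_ofReal {n : ℕ} (a : Fin n → Fin K × Fin K) (r : Fin n → Bool) :
    ∏ t, I.feedback (a t) (r t) = ENNReal.ofReal (I.feedbackWeight a r) := by
  rw [feedbackWeight, ENNReal.ofReal_prod_of_nonneg fun _ _ => ENNReal.toReal_nonneg]
  exact Finset.prod_congr rfl fun t _ => (ENNReal.ofReal_toReal (PMF.apply_ne_top _ _)).symm

/-- The histories with a nondegenerate Gram form and a large noise. -/
def noisyHistories (n : ℕ) (δ : ℝ) : Set (DuelHistory K n) :=
  {h | (∀ u, u ≠ 0 → 0 < I.gram (fun t => (h t).1) u) ∧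
    ¬ ∀ u, inner ℝ (I.noise h) u ^ 2 ≤ d * Real.log (2 / δ) * I.gram (fun t => (h t).1) u}

variable {policy : (t : ℕ) → DuelHistory K t → PMF (Fin K × Fin K)}

/-- The queries may be random but ignore the feedback, so the tail for fixed queries can be averaged
over them. For degenerate queries the event is empty by definition. -/
theorem historyLaw_noisyHistories_le {n : ℕ} (hd : 1 ≤ d)
    (hpol : ∀ t < n, ∀ h h', policy t h = policy t h') {δ : ℝ} (hδ : 0 < δ) :
    (I.historyLaw policy n).toMeasure (I.noisyHistories n δ) ≤ ENNReal.ofReal δ := by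
  classical
  rw [PMF.toMeasure_apply_fintype]
  have h1 : ∀ h, (I.noisyHistories n δ).indicator (I.historyLaw policy n) h =
      I.historyLaw policy n h * (I.noisyHistories n δ).indicator 1 h := fun h => by
    simp [Set.indicator_apply]
  simp only [h1]
  refine I.sum_historyLaw_mul_le hpol fun a => ?_
  by_cases ha : ∀ u, u ≠ 0 → 0 < I.gram a u
  · refine le_trans (le_of_eq ?_)
      (ENNReal.ofReal_le_ofReal (I.sum_feedbackWeight_noise_le hd a ha hδ))
    rw [ENNReal.ofReal_sum_of_nonneg fun r _ =>
      Set.indicator_nonneg (fun r _ => I.feedbackWeight_nonneg a r) r]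
    refine Finset.sum_congr rfl fun r _ => ?_
    rw [prod_feedback_eq_ofReal]
    by_cases hr : ∀ u, inner ℝ (I.noise fun t => (a t, r t)) u ^ 2 ≤
      d * Real.log (2 / δ) * I.gram a u
    · rw [Set.indicator_of_notMem, Set.indicator_of_notMem, mul_zero, ENNReal.ofReal_zero]
      · exact fun h => h hr
      · exact fun h => h.2 hr
    · rw [Set.indicator_of_mem, Set.indicator_of_mem, Pi.one_apply, mul_one]
      · exact hr
      · exact ⟨ha, hr⟩
  · refine le_trans (le_of_eq (Finset.sum_eq_zero fun r _ => ?_)) zero_le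
    rw [Set.indicator_of_notMem, mul_zero]
    exact fun h => ha h.1

/-! ### Regret -/

variable [NeZero K]

theorem borda_mem (i : Fin K) : I.borda i ∈ Set.Icc (0 : ℝ) 1 := by
  have hK : (0 : ℝ) < K := Nat.cast_pos.2 (NeZero.pos K)
  have h : ∑ j, I.pref i j ≤ ∑ _j : Fin K, (1 : ℝ) :=
    Finset.sum_le_sum fun j _ => I.pref_le_one i j
  rw [Finset.sum_const, Finset.card_univ, Fintype.card_fin, nsmul_eq_mul, mul_one] at h
  refine ⟨mul_nonneg (by positivity) (Finset.sum_nonneg fun j _ => I.pref_nonneg i j), ?_⟩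
  rw [borda, one_div, inv_mul_le_iff₀ hK, mul_one]
  exact h

theorem round_regret_le_two (p : Fin K × Fin K) :
    2 * (⨆ i, I.borda i) - I.borda p.1 - I.borda p.2 ≤ 2 := by
  have h1 : (⨆ i, I.borda i) ≤ 1 := ciSup_le fun i => (I.borda_mem i).2
  have h2 := (I.borda_mem p.1).1
  have h3 := (I.borda_mem p.2).1
  linarith

theorem regret_le_two_mul {T : ℕ} (h : DuelHistory K T) : I.regret h ≤ 2 * T := by
  have : I.regret h ≤ ∑ _t : Fin T, (2 : ℝ) :=
    Finset.sum_le_sum fun t _ => I.round_regret_le_two (h t).1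
  simpa [mul_comm] using this

theorem regret_le_of_forall {n T : ℕ} {γ : ℝ} (hγ : 0 ≤ γ) {h : DuelHistory K T}
    (hh : ∀ t : Fin T, n ≤ t →
      2 * (⨆ i, I.borda i) - I.borda (h t).1.1 - I.borda (h t).1.2 ≤ γ) :
    I.regret h ≤ 2 * n + T * γ := by
  have h1 : I.regret h ≤ ∑ t : Fin T, ((if (t : ℕ) < n then 2 else 0) + γ) := by
    refine Finset.sum_le_sum fun t _ => ?_
    split_ifs with ht
    · linarith [I.round_regret_le_two (h t).1]
    · linarith [hh t (not_lt.1 ht)]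
  refine h1.trans ?_
  rw [Finset.sum_add_distrib, Fin.sum_univ_eq_sum_range (fun t => if t < n then (2 : ℝ) else 0),
    ← Finset.sum_filter, Finset.sum_const, Finset.sum_const, Finset.card_univ, Fintype.card_fin,
    nsmul_eq_mul, nsmul_eq_mul]
  have h2 : ((Finset.range T).filter (· < n)).card ≤ n := by
    refine (Finset.card_le_card fun t ht => ?_).trans (Finset.card_range n).le
    simpa using (Finset.mem_filter.1 ht).2
  have h3 : (((Finset.range T).filter (· < n)).card : ℝ) ≤ n := by exact_mod_cast h2
  linarith

end GLMDuelingBandit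

/-! ### The designed exploration -/

theorem List.sum_map_flatMap {α β : Type*} (l : List α) (g : α → List β) (f : β → ℝ) :
    ((l.flatMap g).map f).sum = (l.map fun x => ((g x).map f).sum).sum := by
  induction l with
  | nil => rfl
  | cons x l ih => simp [ih]

theorem sum_map_designSchedule {K : ℕ} (N : Fin K × Fin K → ℕ) (f : Fin K × Fin K → ℝ) :
    ((designSchedule N).map f).sum = ∑ p, N p * f p := by
  simp only [Fintype.sum_prod_type, Fin.sum_univ_def, designSchedule, List.sum_map_flatMap,
    List.map_replicate, List.sum_replicate, nsmul_eq_mul]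

theorem length_designSchedule {K : ℕ} (N : Fin K × Fin K → ℕ) :
    ((designSchedule N).length : ℝ) = ∑ p, (N p : ℝ) := by
  have := sum_map_designSchedule N fun _ => 1
  simpa using this

theorem length_designSchedule_designCount_le {K d : ℕ} {ε : ℝ} (hε : 0 < ε)
    {w : Fin K × Fin K → ℝ} (hw : ∀ p, 0 ≤ w p) (hw1 : ∑ p, w p = 1) :
    ((designSchedule (designCount d ε w)).length : ℝ) ≤
      d / ε ^ 2 + (Function.support w).ncard := by
  classical
  rw [length_designSchedule]
  have h1 : ∀ p, (designCount d ε w p : ℝ) ≤ d / ε ^ 2 * w p + if w p ≠ 0 then 1 else 0 :=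
    fun p => by
      unfold designCount
      split_ifs with hp
      · refine (Nat.ceil_lt_add_one (by have := hw p; positivity)).le.trans (le_of_eq ?_)
        ring
      · rw [not_not] at hp
        simp [hp]
  refine (Finset.sum_le_sum fun p _ => h1 p).trans (le_of_eq ?_)
  rw [Finset.sum_add_distrib, ← Finset.mul_sum, hw1, mul_one, Set.ncard_eq_toFinset_card',
    Finset.sum_boole]
  congr 3
  ext p
  simp

namespace GLMDuelingBandit

variable {K d : ℕ} {I : GLMDuelingBandit K d}

/-- The uniform rounds contribute only nonnegative squares and are discarded. -/
theorem sum_map_le_gram {τ : ℕ} {l : List (Fin K × Fin K)}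
    {a : Fin (τ + l.length) → Fin K × Fin K}
    (ha : ∀ s : Fin l.length, a (Fin.natAdd τ s) = l[s]) (u : EuclideanSpace ℝ (Fin d)) :
    (l.map fun p => (inner ℝ (I.feature p.1 p.2) u : ℝ) ^ 2).sum ≤ I.gram a u := by
  rw [gram, Fin.sum_univ_add]
  simp only [ha]
  rw [← Fin.sum_univ_fun_getElem]
  exact le_add_of_nonneg_left (Finset.sum_nonneg fun t _ => sq_nonneg _)

/-- The designed exploration controls all features. -/
theorem IsGOptimal.inner_sq_le_gram [NeZero K] {lam : ℝ} (h : I.FeatureRegularity lam)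
    (hlam : 0 < lam) (hd : 1 ≤ d) {w : Fin K × Fin K → ℝ} (hw : I.IsGOptimal w) {ε : ℝ}
    (hε : 0 < ε) {τ : ℕ} {a : Fin (explorationLength d τ ε w) → Fin K × Fin K}
    (ha : ∀ s : Fin (designSchedule (designCount d ε w)).length,
      a (Fin.natAdd τ s) = (designSchedule (designCount d ε w))[s])
    (p : Fin K × Fin K) (u : EuclideanSpace ℝ (Fin d)) :
    inner ℝ (I.feature p.1 p.2) u ^ 2 ≤ ε ^ 2 * I.gram a u := by
  have h1 := sum_map_le_gram (I := I) ha u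
  rw [sum_map_designSchedule] at h1
  have h2 : d / ε ^ 2 * ∑ q : Fin K × Fin K, w q * inner ℝ (I.feature q.1 q.2) u ^ 2 ≤
      ∑ q : Fin K × Fin K, designCount d ε w q * inner ℝ (I.feature q.1 q.2) u ^ 2 := by
    rw [Finset.mul_sum]
    refine Finset.sum_le_sum fun q _ => ?_
    rw [← mul_assoc]
    refine mul_le_mul_of_nonneg_right ?_ (sq_nonneg _)
    refine le_trans (le_of_eq ?_) (Nat.le_ceil _)
    ring
  have h3 := hw.inner_sq_le h hlam hd p u
  have h4 := mul_le_mul_of_nonneg_left (h2.trans h1) (sq_nonneg ε)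
  refine h3.trans (le_trans (le_of_eq ?_) h4)
  field_simp

variable [NeZero K] {τ : ℕ} {ε : ℝ} {w : Fin K × Fin K → ℝ}
  {rule : I.CommitRule (explorationLength d τ ε w)}

theorem betcPolicy_congr {t : ℕ} (ht : t < explorationLength d τ ε w) (h h' : DuelHistory K t) :
    I.betcPolicy τ ε w rule t h = I.betcPolicy τ ε w rule t h' := by
  unfold betcPolicy
  split_ifs with h1 h2
  · rfl
  · rfl
  · unfold explorationLength at ht; omega

theorem query_eq_of_design {T : ℕ} {h : DuelHistory K T}
    (hh : h ∈ (I.historyLaw (I.betcPolicy τ ε w rule) T).support)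
    (s : Fin (designSchedule (designCount d ε w)).length) (hs : τ + s < T) :
    (h ⟨τ + s, hs⟩).1 = (designSchedule (designCount d ε w))[s] := by
  have := I.mem_support_policy _ hh ⟨τ + s, hs⟩
  rw [betcPolicy, dif_neg (by simp), dif_pos (by simp), PMF.support_pure,
    Set.mem_singleton_iff] at this
  simpa using this

theorem query_eq_of_commit {T : ℕ} {h : DuelHistory K T}
    (hh : h ∈ (I.historyLaw (I.betcPolicy τ ε w rule) T).support)
    (hn : explorationLength d τ ε w ≤ T) (t : Fin T) (ht : explorationLength d τ ε w ≤ t) :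
    (h t).1 = (rule.arm (h.take hn), rule.arm (h.take hn)) := by
  have := I.mem_support_policy _ hh t
  unfold explorationLength at ht
  rw [betcPolicy, dif_neg (by omega), dif_neg (by omega), PMF.support_pure,
    Set.mem_singleton_iff] at this
  exact this

/-- The regret of explore-then-commit outside an event of probability at most `δ`. -/
theorem betcLaw_regret_le {L M lam δ : ℝ} {T : ℕ} (hd : 1 ≤ d) (hlam : 0 < lam)
    (hreg : I.FeatureRegularity lam) (hκ : 0 < I.kappa) (hsm : I.LinkSmooth L M)
    (hw : I.IsGOptimal w) (hε : 0 < ε) (hδ : 0 < δ) (hδ2 : δ ≤ 2)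
    (hsmall : d * Real.log (2 / δ) * ε ^ 2 < I.kappa ^ 2 * lam)
    (hn : explorationLength d τ ε w ≤ T) :
    I.betcLaw τ ε w rule T {h | ¬ I.regret h ≤ 2 * explorationLength d τ ε w +
      T * (4 * (L * (ε * √(d * Real.log (2 / δ)) / I.kappa)))} ≤ ENNReal.ofReal δ := by
  have hL : 0 ≤ L := hκ.le.trans (kappa_le hsm)
  have hlog : 0 ≤ d * Real.log (2 / δ) :=
    mul_nonneg (Nat.cast_nonneg d) (Real.log_nonneg ((one_le_div hδ).2 hδ2))
  -- On the support of the law, a large regret forces the exploration data to be noisy; the event is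
  -- thereby moved to the first rounds.
  refine le_trans ?_ (I.historyLaw_noisyHistories_le
    (policy := I.betcPolicy τ ε w rule) (n := explorationLength d τ ε w) hd
    (fun t ht h h' => betcPolicy_congr ht h h') hδ)
  rw [← I.historyLaw_map_take _ hn, PMF.toMeasure_map_apply _ _ _ Measurable.of_discrete
    MeasurableSet.of_discrete]
  refine PMF.toMeasure_mono _ MeasurableSet.of_discrete fun h ⟨hR, hh⟩ => ?_
  have hgram := hw.inner_sq_le_gram hreg hlam hd hε
    (a := fun t => (h.take hn t).1) fun s => query_eq_of_design hh s (by
      have := s.2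
      unfold explorationLength at hn
      omega)
  have hpos : ∀ u, u ≠ 0 → 0 < I.gram (fun t => (h.take hn t).1) u := fun u hu => by
    have h1 := hreg.mul_norm_sq_le_of_forall fun p => hgram p u
    have h2 : 0 < lam * ‖u‖ ^ 2 := by have := norm_pos_iff.2 hu; positivity
    exact pos_of_mul_pos_right (h2.trans_le h1) (sq_nonneg ε)
  refine ⟨hpos, fun hnoise => hR ?_⟩
  refine I.regret_le_of_forall (by positivity) fun t ht => ?_
  rw [query_eq_of_commit hh hn t ht]
  refine rule.two_mul_iSup_borda_sub_le hsm hκ hreg hε (Real.sqrt_nonneg _) hgram ?_ ?_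
  · rwa [Real.sq_sqrt hlog]
  · rwa [Real.sq_sqrt hlog]

end GLMDuelingBandit
end

noncomputable section

/-! ### Arithmetic of the rates. -/

section Rates

theorem designAccuracy_pos {d T : ℕ} (hd : 1 ≤ d) (hT : d ≤ T) : 0 < designAccuracy d T := by
  have h1 : (0 : ℝ) < d := by exact_mod_cast hd
  have h2 : (0 : ℝ) < T := by exact_mod_cast hd.trans hT
  unfold designAccuracy
  positivity

theorem designAccuracy_sq {d T : ℕ} :
    designAccuracy d T ^ 2 = (d : ℝ) ^ (1 / 3 : ℝ) * (T : ℝ) ^ (-(2 / 3) : ℝ) := by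
  unfold designAccuracy
  rw [mul_pow, ← Real.rpow_mul_natCast (Nat.cast_nonneg d),
    ← Real.rpow_mul_natCast (Nat.cast_nonneg T)]
  norm_num

theorem div_designAccuracy_sq {d T : ℕ} (hd : 1 ≤ d) (hT : d ≤ T) :
    d / designAccuracy d T ^ 2 = (d : ℝ) ^ (2 / 3 : ℝ) * (T : ℝ) ^ (2 / 3 : ℝ) := by
  have h1 : (0 : ℝ) < d := by exact_mod_cast hd
  have h2 : (0 : ℝ) < T := by exact_mod_cast hd.trans hT
  rw [div_eq_iff (pow_pos (designAccuracy_pos hd hT) 2).ne', designAccuracy_sq]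
  calc (d : ℝ) = (d : ℝ) ^ (2 / 3 + 1 / 3 : ℝ) * (T : ℝ) ^ (2 / 3 + -(2 / 3) : ℝ) := by norm_num
    _ = _ := by rw [Real.rpow_add h1, Real.rpow_add h2]; ring

/-- The squared form of `P = T ε √d`, the size of the commit cost. -/
theorem rate_sq {d T : ℕ} (hd : 1 ≤ d) (hT : d ≤ T) :
    ((d : ℝ) ^ (2 / 3 : ℝ) * (T : ℝ) ^ (2 / 3 : ℝ)) ^ 2 = T ^ 2 * designAccuracy d T ^ 2 * d := by
  have h1 : (0 : ℝ) < d := by exact_mod_cast hd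
  have h2 : (0 : ℝ) < T := by exact_mod_cast hd.trans hT
  rw [designAccuracy_sq, mul_pow, ← Real.rpow_mul_natCast h1.le, ← Real.rpow_mul_natCast h2.le]
  calc _ = (d : ℝ) ^ (1 / 3 + 1 : ℝ) * (T : ℝ) ^ (2 + -(2 / 3) : ℝ) := by norm_num
    _ = _ := by
      rw [Real.rpow_add h1, Real.rpow_add h2, Real.rpow_one, Real.rpow_two]; ring

theorem cast_le_rate {d T : ℕ} (hd : 1 ≤ d) (hT : d ≤ T) :
    (d : ℝ) ≤ (d : ℝ) ^ (2 / 3 : ℝ) * (T : ℝ) ^ (2 / 3 : ℝ) := by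
  have h1 : (1 : ℝ) ≤ d := by exact_mod_cast hd
  have h2 : (d : ℝ) ≤ T := by exact_mod_cast hT
  calc (d : ℝ) = (d : ℝ) ^ (2 / 3 + 1 / 3 : ℝ) := by norm_num
    _ = (d : ℝ) ^ (2 / 3 : ℝ) * (d : ℝ) ^ (1 / 3 : ℝ) := Real.rpow_add (by linarith) _ _
    _ ≤ (d : ℝ) ^ (2 / 3 : ℝ) * (T : ℝ) ^ (2 / 3 : ℝ) := by
      gcongr ?_ * ?_
      exact (Real.rpow_le_rpow_of_exponent_le h1 (by norm_num)).trans
        (Real.rpow_le_rpow (by linarith) h2 (by norm_num))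

/-- Write `d² = d^(2/3) (d²)^(2/3)`. This is where `T ≥ c d²` absorbs the rounding cost of the
design, one query per support point. -/
theorem sq_le_mul_rate {d T : ℕ} {c : ℝ} (hc : 0 < c) (h : c * (d : ℝ) ^ 2 ≤ T) :
    (d : ℝ) ^ 2 ≤ c⁻¹ ^ (2 / 3 : ℝ) * ((d : ℝ) ^ (2 / 3 : ℝ) * (T : ℝ) ^ (2 / 3 : ℝ)) := by
  have h0 : (0 : ℝ) ≤ d := Nat.cast_nonneg d
  have h1 : (d : ℝ) ^ 2 ≤ c⁻¹ * T := by rwa [le_inv_mul_iff₀ hc]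
  calc (d : ℝ) ^ 2 = (d : ℝ) ^ (2 / 3 : ℝ) * ((d : ℝ) ^ 2) ^ (2 / 3 : ℝ) := by
        rw [← Real.rpow_natCast_mul h0, ← Real.rpow_add_of_nonneg h0 (by norm_num) (by norm_num)]
        norm_num
    _ ≤ (d : ℝ) ^ (2 / 3 : ℝ) * (c⁻¹ * T) ^ (2 / 3 : ℝ) := by gcongr
    _ = _ := by rw [Real.mul_rpow (by positivity) (Nat.cast_nonneg T)]; ring

theorem sqrt_le_rate {d T : ℕ} (hd : 1 ≤ d) (hT : d ≤ T) :
    √(T : ℝ) ≤ (d : ℝ) ^ (2 / 3 : ℝ) * (T : ℝ) ^ (2 / 3 : ℝ) := by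
  have h1 : (1 : ℝ) ≤ d := by exact_mod_cast hd
  have h2 : (1 : ℝ) ≤ T := by exact_mod_cast hd.trans hT
  rw [Real.sqrt_eq_rpow]
  refine (Real.rpow_le_rpow_of_exponent_le h2 (by norm_num)).trans
    (le_mul_of_one_le_left (by positivity) (Real.one_le_rpow h1 (by norm_num)))

variable {d T : ℕ} {δ : ℝ}

theorem log_inv_le_log_div (hd : 1 ≤ d) (hT : d ≤ T) (hδ : 0 < δ) :
    Real.log (1 / δ) ≤ Real.log (T / (d * δ)) := by
  have h1 : (0 : ℝ) < d := by exact_mod_cast hd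
  have h2 : (d : ℝ) ≤ T := by exact_mod_cast hT
  refine Real.log_le_log (by positivity) ?_
  rw [div_le_div_iff₀ hδ (by positivity), one_mul]
  exact mul_le_mul_of_nonneg_right h2 hδ.le

theorem one_le_mul_sqrt_log (hd : 1 ≤ d) (hT : d ≤ T) (hδ : 0 < δ) (hδ2 : δ ≤ 1 / 2) :
    1 ≤ 5 / 4 * √(Real.log (T / (d * δ))) := by
  have h1 : Real.log 2 ≤ Real.log (1 / δ) := Real.log_le_log two_pos (by
    rw [le_div_iff₀ hδ]; linarith)
  have h2 := h1.trans (log_inv_le_log_div hd hT hδ)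
  have h3 := Real.log_two_gt_d9
  -- The constant `5 / 4` works because `log 2 > 16 / 25`.
  have : 4 / 5 ≤ √(Real.log (T / (d * δ))) := Real.le_sqrt_of_sq_le (by norm_num; linarith)
  linarith

theorem sqrt_log_two_div_le (hd : 1 ≤ d) (hT : d ≤ T) (hδ : 0 < δ) (hδ2 : δ ≤ 1 / 2) :
    √(Real.log (2 / δ)) ≤ √2 * √(Real.log (T / (d * δ))) := by
  rw [← Real.sqrt_mul two_pos.le]
  refine Real.sqrt_le_sqrt ?_
  have h1 := log_inv_le_log_div hd hT hδ
  have h2 : Real.log (2 / δ) ≤ 2 * Real.log (1 / δ) := by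
    rw [← Real.log_rpow (by positivity)]
    refine Real.log_le_log (by positivity) ?_
    rw [Real.rpow_two, div_pow, div_le_div_iff₀ hδ (by positivity)]
    nlinarith
  linarith

/-- The length of the exploration, cut off at the horizon. -/
theorem min_explorationLength_le {K : ℕ} {C₄ lam c : ℝ} (hC : 0 ≤ C₄) (hc : 0 < c)
    (hcT : c * (d : ℝ) ^ 2 ≤ T) (hd : 1 ≤ d) (hT : d ≤ T) (hδ : 0 < δ) (hδ2 : δ ≤ 1 / 2)
    {w : Fin K × Fin K → ℝ} (hw : ∀ p, 0 ≤ w p) (hw1 : ∑ p, w p = 1)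
    (hsupp : (Function.support w).ncard ≤ d * (d + 1) / 2) :
    min (T : ℝ) (explorationLength d (uniformRounds C₄ lam d δ) (designAccuracy d T) w) ≤
      (5 / 4 * (C₄ * (lam ^ 2)⁻¹ + 2 + c⁻¹ ^ (2 / 3 : ℝ)) + √(C₄ * (lam ^ 2)⁻¹)) *
        ((d : ℝ) ^ (2 / 3 : ℝ) * (T : ℝ) ^ (2 / 3 : ℝ)) * √(Real.log (T / (d * δ))) := by
  set P := (d : ℝ) ^ (2 / 3 : ℝ) * (T : ℝ) ^ (2 / 3 : ℝ) with hP
  set s := √(Real.log (T / (d * δ))) with hs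
  set A := C₄ * (lam ^ 2)⁻¹ with hA
  set x := Real.log (1 / δ) with hx
  have hA0 : 0 ≤ A := by positivity
  have hd1 : (1 : ℝ) ≤ d := by exact_mod_cast hd
  have hdP : (d : ℝ) ≤ P := cast_le_rate hd hT
  have hP0 : 0 < P := by linarith
  have hs1 : 1 ≤ 5 / 4 * s := one_le_mul_sqrt_log hd hT hδ hδ2
  have hx0 : 0 ≤ x := Real.log_nonneg (by rw [le_div_iff₀ hδ]; linarith)
  have hτ : (uniformRounds C₄ lam d δ : ℝ) ≤ A * (d + x) + 1 :=
    (Nat.ceil_lt_add_one (by positivity)).le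
  have hN := length_designSchedule_designCount_le (d := d) (designAccuracy_pos hd hT) hw hw1
  rw [div_designAccuracy_sq hd hT] at hN
  have hsup : ((Function.support w).ncard : ℝ) ≤ c⁻¹ ^ (2 / 3 : ℝ) * P := by
    refine le_trans ?_ (sq_le_mul_rate hc hcT)
    have h1 : ((Function.support w).ncard : ℝ) ≤ ((d * (d + 1) / 2 : ℕ) : ℝ) := by
      exact_mod_cast hsupp
    have h2 : ((d * (d + 1) / 2 : ℕ) : ℝ) ≤ ((d * (d + 1) : ℕ) : ℝ) / 2 := Nat.cast_div_le
    push_cast at h2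
    nlinarith
  -- For tiny `δ` the term `A log (1/δ)` is not bounded by a multiple of `P s`; cutting off at `T`
  -- and using the geometric mean replaces it by its square root.
  have hmin : min (T : ℝ) (A * x) ≤ √A * P * s := by
    have h1 : min (T : ℝ) (A * x) ≤ √T * √(A * x) := by
      have hAx : 0 ≤ A * x := by positivity
      rcases le_total (T : ℝ) (A * x) with h | h
      · rw [min_eq_left h]
        calc (T : ℝ) = √T * √T := (Real.mul_self_sqrt (Nat.cast_nonneg T)).symm
          _ ≤ _ := by gcongr
      · rw [min_eq_right h]
        calc A * x = √(A * x) * √(A * x) := (Real.mul_self_sqrt hAx).symm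
          _ ≤ _ := by gcongr
    refine h1.trans ?_
    rw [Real.sqrt_mul hA0]
    calc √(T : ℝ) * (√A * √x) ≤ P * (√A * s) := by
          gcongr
          · exact sqrt_le_rate hd hT
          · exact Real.sqrt_le_sqrt (log_inv_le_log_div hd hT hδ)
      _ = √A * P * s := by ring
  have hsplit : min (T : ℝ)
      (explorationLength d (uniformRounds C₄ lam d δ) (designAccuracy d T) w) ≤
      min (T : ℝ) (A * x) + (A + 2 + c⁻¹ ^ (2 / 3 : ℝ)) * P := by
    have hE : (explorationLength d (uniformRounds C₄ lam d δ) (designAccuracy d T) w : ℝ) ≤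
        A * x + (A + 2 + c⁻¹ ^ (2 / 3 : ℝ)) * P := by
      unfold explorationLength
      push_cast
      have : A * d ≤ A * P := by gcongr
      linarith
    rw [min_add]
    refine min_le_min ?_ hE
    have : 0 ≤ (A + 2 + c⁻¹ ^ (2 / 3 : ℝ)) * P := by positivity
    linarith
  have h3 : (A + 2 + c⁻¹ ^ (2 / 3 : ℝ)) * P * 1 ≤
      (A + 2 + c⁻¹ ^ (2 / 3 : ℝ)) * P * (5 / 4 * s) := by gcongr
  linarith

end Rates

/-! ### From a tail bound to the final estimates. -/

theorem MeasureTheory.integral_le_add_of_measure_le {Ω : Type*} [Finite Ω] [MeasurableSpace Ω]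
    [DiscreteMeasurableSpace Ω] (μ : MeasureTheory.Measure Ω) [MeasureTheory.IsProbabilityMeasure μ]
    {f : Ω → ℝ} {R B δ : ℝ} (hδ : 0 ≤ δ) (hR : 0 ≤ R) (hB : 0 ≤ B) (hf : ∀ x, f x ≤ B)
    (h : μ {x | ¬ f x ≤ R} ≤ ENNReal.ofReal δ) : ∫ x, f x ∂μ ≤ R + B * δ := by
  have hms : MeasurableSet {x | ¬ f x ≤ R} := MeasurableSet.of_discrete
  calc ∫ x, f x ∂μ ≤ ∫ x, R + {x | ¬ f x ≤ R}.indicator (fun _ => B) x ∂μ := by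
        refine MeasureTheory.integral_mono .of_finite .of_finite fun x => ?_
        by_cases hx : f x ≤ R
        · have : x ∉ {x | ¬ f x ≤ R} := fun h => h hx
          rw [Set.indicator_of_notMem this, add_zero]
          exact hx
        · have : x ∈ {x | ¬ f x ≤ R} := hx
          simp only [Set.indicator_of_mem this]
          linarith [hf x]
    _ = R + μ.real {x | ¬ f x ≤ R} * B := by
        rw [MeasureTheory.integral_add .of_finite .of_finite,
          MeasureTheory.integral_indicator_const _ hms]
        simp
    _ ≤ R + B * δ := by
        have : μ.real {x | ¬ f x ≤ R} ≤ δ := ENNReal.toReal_le_of_le_ofReal hδ h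
        nlinarith

theorem MeasureTheory.one_sub_le_measureReal_le {Ω : Type*} [MeasurableSpace Ω]
    [DiscreteMeasurableSpace Ω] (μ : MeasureTheory.Measure Ω) [MeasureTheory.IsProbabilityMeasure μ]
    {f : Ω → ℝ} {R R' δ : ℝ} (hδ : 0 ≤ δ) (hR : R ≤ R')
    (h : μ {x | ¬ f x ≤ R} ≤ ENNReal.ofReal δ) : 1 - δ ≤ μ.real {x | f x ≤ R'} := by
  have h1 : μ.real {x | ¬ f x ≤ R} ≤ δ := ENNReal.toReal_le_of_le_ofReal hδ h
  have h2 := MeasureTheory.probReal_add_probReal_compl (μ := μ) (s := {x | f x ≤ R})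
    MeasurableSet.of_discrete
  have h3 : μ.real {x | f x ≤ R} ≤ μ.real {x | f x ≤ R'} :=
    MeasureTheory.measureReal_mono fun x hx => le_trans hx hR
  rw [Set.compl_ofPred] at h2
  linarith

/-- The constant of the regret bound in high probability. -/
def regretConstant (C₄ lam L c : ℝ) : ℝ :=
  2 * √2 / √lam + |L| * (2 * (5 / 4 * (C₄ * (lam ^ 2)⁻¹ + 2 + c⁻¹ ^ (2 / 3 : ℝ)) +
    √(C₄ * (lam ^ 2)⁻¹)) + 4 * √2)

namespace GLMDuelingBandit

variable {K d T : ℕ} [NeZero K] {I : GLMDuelingBandit K d}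

/-- The regret bound in terms of abstract rates `P` and `s`. -/
theorem betcLaw_regret_le_of_rate {L M lam δ ε P s G : ℝ} {τ : ℕ} (hd : 1 ≤ d) (hlam : 0 < lam)
    (hreg : I.FeatureRegularity lam) (hκ : 0 < I.kappa) (hsm : I.LinkSmooth L M)
    {w : Fin K × Fin K → ℝ} (hw : I.IsGOptimal w) (hε : 0 < ε) (hδ : 0 < δ) (hδ2 : δ ≤ 2)
    (hP : P = T * ε * √d) (hs : 0 ≤ s) (hG : 0 ≤ G)
    (hlog : √(Real.log (2 / δ)) ≤ √2 * s)
    (hmin : min (T : ℝ) (explorationLength d τ ε w) ≤ G * P * s)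
    (rule : I.CommitRule (explorationLength d τ ε w)) :
    I.betcLaw τ ε w rule T
      {h | ¬ I.regret h ≤ (2 * √2 / √lam + L * (2 * G + 4 * √2)) * I.kappa⁻¹ * P * s} ≤
      ENNReal.ofReal δ := by
  have hκL := kappa_le hsm
  have hL0 : 0 < L := hκ.trans_le hκL
  have hP0 : 0 ≤ P := by rw [hP]; positivity
  have hlog0 : 0 ≤ Real.log (2 / δ) := Real.log_nonneg ((one_le_div hδ).2 hδ2)
  have hd0 : (0 : ℝ) ≤ d := Nat.cast_nonneg d
  have hLκ : 1 ≤ L * I.kappa⁻¹ := by rwa [← div_eq_mul_inv, one_le_div hκ]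
  have hκ' : 0 < I.kappa⁻¹ := inv_pos.2 hκ
  -- As `κ ≤ L`, the exploration cost may be multiplied by `L / κ ≥ 1` to share the form of the
  -- commit cost.
  have hexp : 2 * (G * P * s) ≤ L * (2 * G) * I.kappa⁻¹ * P * s := by
    have := mul_le_mul_of_nonneg_left hLκ (by positivity : 0 ≤ 2 * (G * P * s))
    linarith
  have htriv : ∀ {b : ℝ}, 2 * (T : ℝ) ≤ b → I.betcLaw τ ε w rule T
      {h | ¬ I.regret h ≤ b} ≤ ENNReal.ofReal δ := fun {b} hb => by
    have : {h : DuelHistory K T | ¬ I.regret h ≤ b} = ∅ := by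
      ext h
      simpa using (I.regret_le_two_mul h).trans hb
    rw [this, MeasureTheory.measure_empty]
    exact zero_le
  have hc0 : 0 ≤ 2 * √2 / √lam * I.kappa⁻¹ * P * s := by positivity
  have hL4 : 0 ≤ L * (4 * √2) * I.kappa⁻¹ * P * s := by positivity
  -- If the design is too coarse for the likelihood argument, then `κ √lam ≤ ε √(d log (2/δ))`;
  -- multiplying by `T` shows that `2 T` is below the term with `2 √2 / √lam`.
  rcases le_or_gt (I.kappa ^ 2 * lam) (d * Real.log (2 / δ) * ε ^ 2) with hsmall | hsmall
  · refine htriv ?_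
    have h1 : (T * (I.kappa * √lam)) ^ 2 ≤ (P * √(Real.log (2 / δ))) ^ 2 := by
      rw [mul_pow, mul_pow, mul_pow, Real.sq_sqrt hlam.le, Real.sq_sqrt hlog0, hP, mul_pow,
        mul_pow, Real.sq_sqrt hd0]
      have := mul_le_mul_of_nonneg_left hsmall (sq_nonneg (T : ℝ))
      linarith
    have h2 := abs_le_of_sq_le_sq h1 (by positivity)
    have h3 : T * (I.kappa * √lam) ≤ P * (√2 * s) :=
      ((le_abs_self _).trans h2).trans (mul_le_mul_of_nonneg_left hlog hP0)
    have hκl : 0 < I.kappa * √lam := mul_pos hκ (Real.sqrt_pos.2 hlam)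
    rw [← le_div_iff₀ hκl] at h3
    have h4 : 2 * (P * (√2 * s) / (I.kappa * √lam)) = 2 * √2 / √lam * I.kappa⁻¹ * P * s := by
      field_simp
    have h5 : 0 ≤ L * (2 * G) * I.kappa⁻¹ * P * s := by positivity
    linarith
  rcases le_or_gt (explorationLength d τ ε w) T with hnT | hnT
  · have hnT' : (explorationLength d τ ε w : ℝ) ≤ T := by exact_mod_cast hnT
    rw [min_eq_right hnT'] at hmin
    have h1 : T * (4 * (L * (ε * √(d * Real.log (2 / δ)) / I.kappa))) =
        4 * L * I.kappa⁻¹ * P * √(Real.log (2 / δ)) := by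
      rw [Real.sqrt_mul hd0, hP]; field_simp
    have h2 : 4 * L * I.kappa⁻¹ * P * √(Real.log (2 / δ)) ≤
        4 * L * I.kappa⁻¹ * P * (√2 * s) := mul_le_mul_of_nonneg_left hlog (by positivity)
    have h3 : 2 * explorationLength d τ ε w +
        T * (4 * (L * (ε * √(d * Real.log (2 / δ)) / I.kappa))) ≤
        (2 * √2 / √lam + L * (2 * G + 4 * √2)) * I.kappa⁻¹ * P * s := by
      rw [h1]
      linarith
    exact le_trans (MeasureTheory.measure_mono fun h hh hle => hh (le_trans hle h3))
      (betcLaw_regret_le hd hlam hreg hκ hsm hw hε hδ hδ2 hsmall hnT (rule := rule))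
  -- Exploration outlasts the horizon: the minimum is `T`, so the trivial bound `2 T` suffices.
  · have hnT' : (T : ℝ) ≤ explorationLength d τ ε w := by exact_mod_cast hnT.le
    rw [min_eq_left hnT'] at hmin
    refine htriv ?_
    linarith

/-- The regret bound in high probability for `δ ≤ 1 / 2`. -/
theorem betcLaw_regret_le_rate {C₄ lam L M c δ : ℝ} (hC : 0 ≤ C₄) (hlam : 0 < lam) (hc : 0 < c)
    (hd : 1 ≤ d) (hreg : I.FeatureRegularity lam) (hκ : 0 < I.kappa) (hsm : I.LinkSmooth L M)
    (hcT : c * (d : ℝ) ^ 2 ≤ T) (hT : d ≤ T) {w : Fin K × Fin K → ℝ} (hw : I.IsGOptimal w)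
    (hsupp : (Function.support w).ncard ≤ d * (d + 1) / 2) (hδ : 0 < δ) (hδ2 : δ ≤ 1 / 2)
    (rule : I.CommitRule
      (explorationLength d (uniformRounds C₄ lam d δ) (designAccuracy d T) w)) :
    I.betcLaw (uniformRounds C₄ lam d δ) (designAccuracy d T) w rule T
      {h | ¬ I.regret h ≤ regretConstant C₄ lam L c * I.kappa⁻¹ * (d : ℝ) ^ (2 / 3 : ℝ) *
        (T : ℝ) ^ (2 / 3 : ℝ) * √(Real.log (T / (d * δ)))} ≤ ENNReal.ofReal δ := by
  have hL0 : 0 < L := hκ.trans_le (kappa_le hsm)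
  have hε := designAccuracy_pos hd hT
  have hP : (d : ℝ) ^ (2 / 3 : ℝ) * (T : ℝ) ^ (2 / 3 : ℝ) = T * designAccuracy d T * √d := by
    rw [← abs_of_nonneg (by positivity : 0 ≤ (d : ℝ) ^ (2 / 3 : ℝ) * (T : ℝ) ^ (2 / 3 : ℝ)),
      ← abs_of_nonneg (by positivity : 0 ≤ T * designAccuracy d T * √(d : ℝ)),
      ← sq_eq_sq_iff_abs_eq_abs, rate_sq hd hT, mul_pow, mul_pow, Real.sq_sqrt (Nat.cast_nonneg d)]
  have h := betcLaw_regret_le_of_rate hd hlam hreg hκ hsm hw hε hδ (by linarith) hP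
    (Real.sqrt_nonneg _) (by positivity) (sqrt_log_two_div_le hd hT hδ hδ2)
    (min_explorationLength_le (lam := lam) hC hc hcT hd hT hδ hδ2 hw.1.1 hw.1.2.1 hsupp) rule
  rw [regretConstant, abs_of_pos hL0, mul_assoc _ ((d : ℝ) ^ (2 / 3 : ℝ))]
  exact h

end GLMDuelingBandit

end

theorem theorem5p1 :
    ∃ C₀ : ℝ, 0 < C₀ ∧ ∀ C₄ : ℝ, C₀ ≤ C₄ →
      -- the remaining constant may depend on the quantities introduced up to here
      ∀ lam L M c : ℝ, 0 < lam → 0 < c → ∃ C : ℝ, 0 < C ∧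
      ∀ (K d T : ℕ) [NeZero K] (I : GLMDuelingBandit K d), 1 ≤ d →
        I.FeatureRegularity lam → 0 < I.kappa → I.LinkSmooth L M →
        c * (d : ℝ) ^ 2 ≤ (T : ℝ) → d ≤ T →
        -- a G-optimal design of small support exists
        (∃ w, I.IsGOptimal w ∧ (Function.support w).ncard ≤ d * (d + 1) / 2) ∧
        ∀ w : Fin K × Fin K → ℝ, I.IsGOptimal w →
          (Function.support w).ncard ≤ d * (d + 1) / 2 →
          -- the bound in high probability
          (∀ (δ : ℝ), 0 < δ →
            ∀ rule : I.CommitRule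
              (explorationLength d (uniformRounds C₄ lam d δ) (designAccuracy d T) w),
            1 - 2 * δ ≤
              (I.betcLaw (uniformRounds C₄ lam d δ) (designAccuracy d T) w rule T).real
                {h | I.regret h ≤ C * I.kappa⁻¹ * (d : ℝ) ^ (2 / 3 : ℝ) * (T : ℝ) ^ (2 / 3 : ℝ) *
                  Real.sqrt (Real.log ((T : ℝ) / ((d : ℝ) * δ)))}) ∧
          -- the bound in expectation, for `δ = 1 / T`
          (∀ rule : I.CommitRule
              (explorationLength d (uniformRounds C₄ lam d (T : ℝ)⁻¹) (designAccuracy d T) w),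
            ∫ h, I.regret h
                ∂(I.betcLaw (uniformRounds C₄ lam d (T : ℝ)⁻¹) (designAccuracy d T) w rule T) ≤
              C * I.kappa⁻¹ * (d : ℝ) ^ (2 / 3 : ℝ) * (T : ℝ) ^ (2 / 3 : ℝ) *
                Real.sqrt (1 + Real.log (T : ℝ))) := by
  refine ⟨1, one_pos, fun C₄ hC₄ lam L M c hlam hc => ?_⟩
  have hC0 : 0 ≤ C₄ := zero_le_one.trans hC₄
  have hR0 : 0 ≤ regretConstant C₄ lam L c := by unfold regretConstant; positivity
  -- `√2` converts the logarithm at `δ = 1 / T`; `4 |L|` absorbs additive constants up to 4, because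
  -- `L / κ ≥ 1`. The sign of `L` is unknown until a bandit is given, hence the absolute value.
  refine ⟨√2 * regretConstant C₄ lam L c + 4 * |L| + 1, by positivity, ?_⟩
  intro K d T _ I hd hreg hκ hsm hcT hT
  refine ⟨hreg.exists_isGOptimal hlam hd, fun w hw hsupp => ?_⟩
  have hκ' : 0 < I.kappa⁻¹ := inv_pos.2 hκ
  have hd1 : (1 : ℝ) ≤ d := by exact_mod_cast hd
  have hT1 : (1 : ℝ) ≤ T := by exact_mod_cast hd.trans hT
  have hs2 : (1 : ℝ) ≤ √2 := Real.one_le_sqrt.2 one_le_two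
  have hP1 : 1 ≤ (d : ℝ) ^ (2 / 3 : ℝ) * (T : ℝ) ^ (2 / 3 : ℝ) := hd1.trans (cast_le_rate hd hT)
  have hprob : ∀ τ ε (rule : I.CommitRule (explorationLength d τ ε w)),
      MeasureTheory.IsProbabilityMeasure (I.betcLaw τ ε w rule T) := fun τ ε rule => by
    unfold GLMDuelingBandit.betcLaw; infer_instance
  constructor
  · intro δ hδ rule
    rcases le_or_gt (1 / 2) δ with hδ2 | hδ2
    · exact le_trans (by linarith) MeasureTheory.measureReal_nonneg
    have := hprob _ _ rule
    have h := GLMDuelingBandit.betcLaw_regret_le_rate hC0 hlam hc hd hreg hκ hsm hcT hT hw hsupp hδ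
      hδ2.le rule
    refine le_trans (by linarith) (MeasureTheory.one_sub_le_measureReal_le _ hδ.le ?_ h)
    gcongr
    nlinarith [abs_nonneg L]
  · intro rule
    have := hprob _ _ rule
    have hlogT : 0 ≤ Real.log T := Real.log_nonneg hT1
    have hs1 : 1 ≤ √(1 + Real.log T) := Real.one_le_sqrt.2 (by linarith)
    have hκL := GLMDuelingBandit.kappa_le hsm
    have hL0 : 0 < L := hκ.trans_le hκL
    rw [mul_assoc _ ((d : ℝ) ^ (2 / 3 : ℝ)), abs_of_pos hL0]
    set P := (d : ℝ) ^ (2 / 3 : ℝ) * (T : ℝ) ^ (2 / 3 : ℝ) with hP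
    set s := √(1 + Real.log T) with hs
    have hLκ : 1 ≤ L * I.kappa⁻¹ := by rwa [← div_eq_mul_inv, one_le_div hκ]
    have h4 : 4 ≤ 4 * L * I.kappa⁻¹ * P * s := by
      have h5 : 1 ≤ P * s := one_le_mul_of_one_le_of_one_le hP1 hs1
      have h6 : 1 ≤ (L * I.kappa⁻¹) * (P * s) := one_le_mul_of_one_le_of_one_le hLκ h5
      linarith
    have hr : 0 ≤ √2 * regretConstant C₄ lam L c * I.kappa⁻¹ * P * s := by positivity
    have h0 : 0 ≤ I.kappa⁻¹ * P * s := by positivity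
    -- The tail bound requires `δ = 1 / T ≤ 1 / 2`; small horizons are covered by the trivial bound
    -- 4.
    rcases Nat.lt_or_ge T 3 with hT3 | hT3
    · have hle : ∀ h : DuelHistory K T, I.regret h ≤ 4 := fun h => by
        have h2 : (T : ℝ) ≤ 2 := by exact_mod_cast Nat.le_of_lt_succ hT3
        linarith [I.regret_le_two_mul h]
      have h5 := MeasureTheory.integral_mono (μ := I.betcLaw (uniformRounds C₄ lam d (T : ℝ)⁻¹)
        (designAccuracy d T) w rule T) (f := I.regret) .of_finite
        (MeasureTheory.integrable_const (4 : ℝ)) hle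
      rw [MeasureTheory.integral_const, MeasureTheory.probReal_univ, one_smul] at h5
      linarith
    · have hT3' : (3 : ℝ) ≤ T := by exact_mod_cast hT3
      have hδ : 0 < (T : ℝ)⁻¹ := by positivity
      have hδ2 : (T : ℝ)⁻¹ ≤ 1 / 2 := by
        rw [inv_le_comm₀ (by positivity) (by norm_num)]; norm_num; linarith
      have h := MeasureTheory.integral_le_add_of_measure_le _ hδ.le (by positivity)
        (by positivity : 0 ≤ 2 * (T : ℝ)) I.regret_le_two_mul
        (GLMDuelingBandit.betcLaw_regret_le_rate hC0 hlam hc hd hreg hκ hsm hcT hT hw hsupp hδ hδ2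
          rule)
      refine h.trans ?_
      have hlog : √(Real.log (T / (d * (T : ℝ)⁻¹))) ≤ √2 * s := by
        rw [hs, ← Real.sqrt_mul two_pos.le]
        refine Real.sqrt_le_sqrt ?_
        have h7 : Real.log (T / (d * (T : ℝ)⁻¹)) ≤ 2 * Real.log T := by
          rw [← Real.log_rpow (by positivity), Real.rpow_two]
          refine Real.log_le_log (by positivity) ?_
          rw [div_le_iff₀ (by positivity)]
          have : (T : ℝ) ^ 2 * (d * (T : ℝ)⁻¹) = T * d := by field_simp
          rw [this]
          exact le_mul_of_one_le_right (by positivity) hd1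
        linarith
      -- The failure event contributes at most `2 T` times its probability `1 / T`.
      have h8 : 2 * (T : ℝ) * (T : ℝ)⁻¹ = 2 := by field_simp
      rw [h8, mul_assoc _ ((d : ℝ) ^ (2 / 3 : ℝ)), ← hP]
      have h9 : regretConstant C₄ lam L c * I.kappa⁻¹ * P * √(Real.log (T / (d * (T : ℝ)⁻¹))) ≤
          regretConstant C₄ lam L c * I.kappa⁻¹ * P * (√2 * s) := by gcongr
      linarith
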